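/- Let $-\infty\le c<d\le\infty$, $I=(c,d)\subset\mathbb R$, and let $L^0(I)$ be the set of classes, modulo equality a.e., of Lebesgue measurable functions $I\to[-\infty,\infty]$. Let $v:I\to[-\infty,\infty]$ be Lebesgue measurable with $\int_c^x|v|<\infty$ for all $x\in I$, such that $$w(x):=\Big(\int_c^x v\Big)^{-1}\in(0,\infty)\quad(x\in I),\qquad \lim_{b\to d-}\int_c^b v=\infty .$$ Let $Ces^\wedge_\infty$ be the space of all $f\in L^0(I)$ with $\int_c^x|f|<\infty$ for all $x\in I$ and $$\|f\|_{Ces^\wedge_\infty}:=\operatorname*{ess\,sup}_{x\in I}\Big|w(x)\int_c^x f\Big|<\infty ,$$ and let $(Ces^\wedge_\infty)'_{\mathrm w}$ be the space of all $g\in L^0(I)$ such that $fg\in L^1(I)$ for all $f\in Ces^\wedge_\infty$ and $$\|g\|_{(Ces^\wedge_\infty)'_{\mathrm w}}:=\sup_{f\in Ces^\wedge_\infty\setminus\{0\}}\frac{\left|\int_I fg\right|}{\|f\|_{Ces^\wedge_\infty}}<\infty .$$ Let $BPV(I)$ be the set of functions $I\to\mathbb R$ of bounded pointwise variation. For $h\in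 BPV(I)$ let $\lambda_h$ be the unique finite signed Borel measure on $I$ with $\lambda_h((a,b])=h(b+)-h(a+)$ for all $a\le b$ in $I$, and let $\|\lambda_h\|=|\lambda_h|(I)$ be its total variation. **Theorem.** For every $g\in L^0(I)$ the following are equivalent: (i) $g\in(Ces^\wedge_\infty)'_{\mathrm w}$; (ii) $vg\in L^1(I)$; some $\tilde g\in BPV(I)$ equals $g/w$ a.e. on $I$; $g\in L^\infty(I)$; and there is $b\in I$ with $g=0$ a.e. on $(b,d)$. Moreover, there is an absolute constant $C<\infty$ (independent of $c,d,v,g,\tilde g$) such that, whenever $v>0$ a.e. on $I$ and $g\in(Ces^\wedge_\infty)'_{\mathrm w}$, every $\tilde g\in BPV(I)$ that equals $g/w$ a.e. on $I$ satisfies $$\|g\|_{(Ces^\wedge_\infty)'_{\mathrm w}}\le C\left(\|vg\|_{L^1(I)}+\|\lambda_{\tilde g}\|\right)\quad\text{and}\quad \|vg\|_{L^1(I)}+\|\lambda_{\tilde g}\|\le C\,\|g\|_{(Ces^\wedge_\infty)'_{\mathrm w}} .$$ -/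

import Mathlib

open MeasureTheory Set Filter Topology
open scoped ENNReal NNReal

namespace AltCesaro

/-- The open interval `I = (c, d)` of the real line; the endpoints may be infinite. -/
def I (c d : EReal) : Set ℝ := {x : ℝ | c < (x : EReal) ∧ (x : EReal) < d}

instance ordConnected_I (c d : EReal) : (I c d).OrdConnected :=
  ⟨fun _ hx _ hy _ hz =>
    ⟨hx.1.trans_le (EReal.coe_le_coe_iff.2 hz.1), (EReal.coe_le_coe_iff.2 hz.2).trans_lt hy.2⟩⟩

instance compactIccSpace_I (c d : EReal) : CompactIccSpace (I c d) := by
  refine ⟨fun {a b} => ?_⟩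
  rw [Subtype.isCompact_iff]
  have h : ((↑) : I c d → ℝ) '' Icc a b = Icc (a : ℝ) (b : ℝ) := by
    ext x
    constructor
    · rintro ⟨y, hy, rfl⟩
      exact hy
    · intro hx
      exact ⟨⟨x, (ordConnected_I c d).out a.2 b.2 hx⟩, hx, rfl⟩
  rw [h]
  exact isCompact_Icc

/-- Lebesgue measure on `I = (c, d)`. -/
noncomputable abbrev leb (c d : EReal) : Measure ℝ := volume.restrict (I c d)

/-- `L⁰(I)`: classes, modulo equality a.e. on `I`, of Lebesgue measurable functions
with values in `[-∞, ∞]`. -/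
abbrev L0 (c d : EReal) := ℝ →ₘ[leb c d] EReal

/-- `‖f‖_{L¹(I)}` (possibly infinite) of a function with values in `[-∞, ∞]`. -/
noncomputable def normL1 (c d : EReal) (f : ℝ → EReal) : ℝ≥0∞ := ∫⁻ x in I c d, (f x).abs

/-- `‖f‖_{L^∞(I)}` (possibly infinite) of a function with values in `[-∞, ∞]`. -/
noncomputable def normLinfty (c d : EReal) (f : ℝ → EReal) : ℝ≥0∞ :=
  essSup (fun x => (f x).abs) (leb c d)

/-- `f ∈ L¹_loc([c, d))`: the integral of `|f|` over `(c, x)` is finite for every `x ∈ I`. -/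
def LocL1 (c d : EReal) (f : ℝ → EReal) : Prop :=
  ∀ x ∈ I c d, ∫⁻ y in I c d ∩ Iio x, (f y).abs < ⊤

/-- `∫_c^x f`. It is only used for `f ∈ L¹_loc([c, d))`; such an `f` is finite a.e., so that
passing to real values changes nothing. -/
noncomputable def primitive (c d : EReal) (f : ℝ → EReal) (x : ℝ) : ℝ :=
  ∫ y in I c d ∩ Iio x, (f y).toReal

/-- The standing assumption on the weight: `v : I → [-∞, ∞]` is Lebesgue measurable,
`v ∈ L¹_loc([c, d))`, `w(x) = (∫_c^x v)⁻¹ ∈ (0, ∞)` for all `x ∈ I`, and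
`∫_c^b v → ∞` as `b → d-`. -/
structure IsWeight (c d : EReal) (v : ℝ → EReal) (w : ℝ → ℝ) : Prop where
  aemeasurable : AEMeasurable v (leb c d)
  locL1 : LocL1 c d v
  eq_inv : ∀ x ∈ I c d, w x = (primitive c d v x)⁻¹
  pos : ∀ x ∈ I c d, 0 < w x
  tendsto : Tendsto (primitive c d v) (comap ((↑) : ℝ → EReal) (𝓝[<] d)) atTop

/-- The norm of the altered Cesàro space: the essential supremum over `x ∈ I` of
`|w(x) ∫_c^x f|`. -/
noncomputable def cesNorm (c d : EReal) (w : ℝ → ℝ) (f : L0 c d) : ℝ≥0∞ :=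
  essSup (fun x => ENNReal.ofReal |w x * primitive c d f x|) (leb c d)

/-- The altered Cesàro space, with `p = ∞` and weight `w`. -/
def Ces (c d : EReal) (w : ℝ → ℝ) : Set (L0 c d) :=
  {f | LocL1 c d f ∧ cesNorm c d w f < ⊤}

/-- The norm in the weak associate space of `(X, N)`: the supremum of `|∫_I h g| / N h` over
`h ∈ X \ {0}`. It is only used when `h g ∈ L¹(I)` for all `h ∈ X`, so that `h g` is finite a.e. -/
noncomputable def weakNorm {c d : EReal} (X : Set (L0 c d)) (N : L0 c d → ℝ≥0∞) (g : L0 c d) :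
    ℝ≥0∞ :=
  ⨆ h ∈ X \ {0}, ENNReal.ofReal |∫ x in I c d, (h x * g x).toReal| / N h

/-- The weak associate space of `(X, N)`. -/
def weakAssociate {c d : EReal} (X : Set (L0 c d)) (N : L0 c d → ℝ≥0∞) : Set (L0 c d) :=
  {g | (∀ f ∈ X, normL1 c d (fun x => f x * g x) < ⊤) ∧ weakNorm X N g < ⊤}

/-- `h ∈ ((1/w) g) ∩ BPV(I)`: `h` is a real function of bounded pointwise variation on `I` that
equals `g / w` a.e. on `I`. -/
def IsBPVRep {c d : EReal} (w : ℝ → ℝ) (g : L0 c d) (h : ℝ → ℝ) : Prop :=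
  BoundedVariationOn h (I c d) ∧ ∀ᵐ x ∂leb c d, (h x : EReal) = ((w x)⁻¹ : ℝ) * g x

theorem bpv_restrict {c d : EReal} {h : ℝ → ℝ} (hh : BoundedVariationOn h (I c d)) :
    BoundedVariationOn ((I c d).domRestrict h) univ := by
  have e := eVariationOn.comp_eq_of_monotoneOn h ((↑) : I c d → ℝ) (t := univ)
    (fun _ _ _ _ hab => hab)
  rw [image_univ, Subtype.range_coe] at e
  exact fun H => hh (e.symm.trans H)

/-- The Lebesgue–Stieltjes measure `λ_h` of `h ∈ BPV(I)`: the finite signed Borel measure on `I`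
with `λ_h((a, b]) = h(b+) - h(a+)` for `a ≤ b` in `I`. -/
noncomputable def stieltjes {c d : EReal} {h : ℝ → ℝ} (hh : BoundedVariationOn h (I c d)) :
    SignedMeasure (I c d) :=
  (bpv_restrict hh).vectorMeasure

end AltCesaro

/-!
Write `V = ∫_c v`, so that `1 / w = V`, and `γ` for the real-valued representative of `g`.

The unit ball of the altered Cesàro space consists of the `f` with `|∫_c^x f| ≤ V x`. It contains
every `f = v η + V η'` with `η` absolutely continuous and `|η| ≤ 1`, since then `∫_c^x f = V η`
(`prim_test`), and conversely every `f` in it has this form, with `η = (∫_c f) / V`.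

*Necessity.* Because the conditions on `f` involve only its primitive, `f` may oscillate. For
`φ ≥ 0` integrable on each `(c, x)`, choosing `Ψ' = φ / V` and `η = sin Ψ`, `η = cos Ψ` shows that
`φ |g|` is integrable (`lintegral_mul_lt_top_of_testBall`). As `φ` is arbitrary, `g` is bounded and
vanishes near `d` (`essSup_lt_top_of_lintegral`, `exists_ae_eq_zero_of_lintegral`). Taking `f = v`
gives `v g ∈ L¹`. Finally, testing with `f = v η + V η'` for compactly supported `η'` gives
`|∫ V γ η'| ≤ ‖g‖ + ‖v g‖₁`: the distributional derivative of `V γ = g / w` is a finite measure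
(`weakVariationLE_of_mem_weakAssociate`). For a suitable piecewise affine `η` the left-hand side is
the variation of the averages of `V γ` over `(x, x + ε)` along a partition; letting `ε → 0` gives a
representative of bounded variation, and bounds the variation of the right limit of any such
representative, hence the total variation of its Stieltjes measure
(`totalVariation_stieltjes_le`). If `v > 0`, then `f = v sgn g` lies in the unit ball, so that
`‖v g‖₁ ≤ ‖g‖`.

*Sufficiency.* For `f` in the space and `η = (∫_c f) / V` one has `f g = (V γ) η' + v g η`. As
`V γ` has bounded variation and vanishes near `d`, integration by parts, in the form of Fubini's
theorem for the two parts of the Jordan decomposition, bounds the integral of the first term by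
`2 sup |η| ‖λ‖` (`abs_integral_rightLimI_mul_deriv_le`). The constant `3` thus serves in both
inequalities.
-/

/-! ### Absolutely continuous functions -/

namespace AbsolutelyContinuousOnInterval

theorem congr_uIcc {f g : ℝ → ℝ} {a b : ℝ} (hf : AbsolutelyContinuousOnInterval f a b)
    (h : EqOn f g (uIcc a b)) : AbsolutelyContinuousOnInterval g a b := by
  rw [absolutelyContinuousOnInterval_iff] at hf ⊢
  intro ε hε
  obtain ⟨δ, hδ, H⟩ := hf ε hε
  refine ⟨δ, hδ, fun E hE hEδ => ?_⟩
  convert! H E hE hEδ using 1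
  refine Finset.sum_congr rfl fun i hi => ?_
  rw [h (hE.1 i hi).1, h (hE.1 i hi).2]

/-- Composition of an absolutely continuous function with a Lipschitz function. -/
theorem lipschitz_comp {f φ : ℝ → ℝ} {a b : ℝ} {K : ℝ≥0}
    (hf : AbsolutelyContinuousOnInterval f a b) (hφ : LipschitzOnWith K φ (f '' uIcc a b)) :
    AbsolutelyContinuousOnInterval (fun x => φ (f x)) a b := by
  rw [absolutelyContinuousOnInterval_iff] at hf ⊢
  intro ε hε
  obtain ⟨δ, hδ, H⟩ := hf (ε / (K + 1)) (by positivity)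
  refine ⟨δ, hδ, fun E hE hEδ => ?_⟩
  calc ∑ i ∈ Finset.range E.1, dist (φ (f (E.2 i).1)) (φ (f (E.2 i).2))
      ≤ ∑ i ∈ Finset.range E.1, K * dist (f (E.2 i).1) (f (E.2 i).2) :=
        Finset.sum_le_sum fun i hi => hφ.dist_le_mul _ (mem_image_of_mem f (hE.1 i hi).1) _
          (mem_image_of_mem f (hE.1 i hi).2)
    _ = K * ∑ i ∈ Finset.range E.1, dist (f (E.2 i).1) (f (E.2 i).2) :=
        (Finset.mul_sum _ _ _).symm
    _ ≤ (K + 1) * ∑ i ∈ Finset.range E.1, dist (f (E.2 i).1) (f (E.2 i).2) := by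
        gcongr; linarith
    _ < (K + 1) * (ε / (K + 1)) := by gcongr; exact H E hE hEδ
    _ = ε := by field

theorem const (k a b : ℝ) : AbsolutelyContinuousOnInterval (fun _ => k) a b :=
  ((LipschitzWith.const (α := ℝ) k).lipschitzOnWith (s := uIcc a b)).absolutelyContinuousOnInterval

theorem sum {ι : Type*} (s : Finset ι) {f : ι → ℝ → ℝ} {a b : ℝ}
    (hf : ∀ i ∈ s, AbsolutelyContinuousOnInterval (f i) a b) :
    AbsolutelyContinuousOnInterval (fun x => ∑ i ∈ s, f i x) a b := by
  classical
  induction s using Finset.induction_on with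
  | empty => simpa using const 0 a b
  | insert i s hi ih =>
    simp only [Finset.sum_insert hi]
    exact (hf i (Finset.mem_insert_self i s)).add
      (ih fun j hj => hf j (Finset.mem_insert_of_mem hj))

theorem inv {f : ℝ → ℝ} {a b : ℝ} (hf : AbsolutelyContinuousOnInterval f a b)
    (h0 : ∀ x ∈ uIcc a b, 0 < f x) : AbsolutelyContinuousOnInterval (fun x => (f x)⁻¹) a b := by
  -- `y ↦ y⁻¹` is Lipschitz on `[m, ∞)`, where `m > 0` is the minimum of `f`
  obtain ⟨x₀, hx₀, hmin⟩ := isCompact_uIcc.exists_isMinOn nonempty_uIcc hf.continuousOn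
  have hδ := h0 x₀ hx₀
  refine hf.lipschitz_comp (K := Real.toNNReal ((f x₀)⁻¹ * (f x₀)⁻¹)) ?_
  refine LipschitzOnWith.of_dist_le_mul ?_
  rintro _ ⟨x, hx, rfl⟩ _ ⟨y, hy, rfl⟩
  have hx0 := h0 x hx
  have hy0 := h0 y hy
  have hxm : f x₀ ≤ f x := hmin hx
  have hym : f x₀ ≤ f y := hmin hy
  rw [Real.coe_toNNReal _ (by positivity), Real.dist_eq, Real.dist_eq,
    inv_sub_inv hx0.ne' hy0.ne', abs_div, abs_of_pos (mul_pos hx0 hy0), div_eq_inv_mul, mul_inv,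
    abs_sub_comm]
  gcongr

end AbsolutelyContinuousOnInterval

namespace AltCesaro

/-! ### The interval and primitives from its left endpoint -/

theorem isOpen_I (c d : EReal) : IsOpen (I c d) :=
  (isOpen_Ioo (a := c) (b := d)).preimage continuous_coe_real_ereal

theorem measurableSet_I (c d : EReal) : MeasurableSet (I c d) := (isOpen_I c d).measurableSet

variable {c d : EReal}

theorem Icc_subset_I {a b : ℝ} (ha : a ∈ I c d) (hb : b ∈ I c d) : Icc a b ⊆ I c d :=
  (ordConnected_I c d).out ha hb

theorem uIcc_subset_I {a b : ℝ} (ha : a ∈ I c d) (hb : b ∈ I c d) : uIcc a b ⊆ I c d :=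
  (ordConnected_I c d).uIcc_subset ha hb

theorem exists_seq_left (hcd : c < d) :
    ∃ a : ℕ → ℝ, Antitone a ∧ (∀ n, a n ∈ I c d) ∧ ∀ x ∈ I c d, ∀ᶠ n in atTop, a n < x := by
  obtain ⟨u, hu, hucd, hlim⟩ := exists_seq_strictAnti_tendsto' hcd
  have hco : ∀ n, ((u n).toReal : EReal) = u n := fun n =>
    EReal.coe_toReal ((hucd n).2.trans_le le_top).ne (bot_le.trans_lt (hucd n).1).ne'
  refine ⟨fun n => (u n).toReal, fun m n hmn => ?_, fun n => ?_, fun x hx => ?_⟩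
  · rw [← EReal.coe_le_coe_iff, hco, hco]
    exact hu.antitone hmn
  · change c < ((u n).toReal : EReal) ∧ ((u n).toReal : EReal) < d
    rw [hco]
    exact hucd n
  · filter_upwards [hlim.eventually_lt_const hx.1] with n hn
    rwa [← EReal.coe_lt_coe_iff, hco]

theorem exists_seq_right (hcd : c < d) :
    ∃ b : ℕ → ℝ, Monotone b ∧ (∀ n, b n ∈ I c d) ∧ ∀ x ∈ I c d, ∀ᶠ n in atTop, x < b n := by
  obtain ⟨u, hu, hucd, hlim⟩ := exists_seq_strictMono_tendsto' hcd
  have hco : ∀ n, ((u n).toReal : EReal) = u n := fun n =>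
    EReal.coe_toReal ((hucd n).2.trans_le le_top).ne (bot_le.trans_lt (hucd n).1).ne'
  refine ⟨fun n => (u n).toReal, fun m n hmn => ?_, fun n => ?_, fun x hx => ?_⟩
  · rw [← EReal.coe_le_coe_iff, hco, hco]
    exact hu.monotone hmn
  · change c < ((u n).toReal : EReal) ∧ ((u n).toReal : EReal) < d
    rw [hco]
    exact hucd n
  · filter_upwards [hlim.eventually_const_lt hx.2] with n hn
    rwa [← EReal.coe_lt_coe_iff, hco]

theorem nonempty_I (hcd : c < d) : (I c d).Nonempty :=
  let ⟨a, _, ha, _⟩ := exists_seq_left hcd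
  ⟨a 0, ha 0⟩

/-- A property holds a.e. on `(c, d)` once it holds a.e. on each compact subinterval. -/
theorem ae_leb_of_forall_Icc (hcd : c < d) {p : ℝ → Prop}
    (h : ∀ a ∈ I c d, ∀ b ∈ I c d, a ≤ b → ∀ᵐ x, x ∈ Icc a b → p x) : ∀ᵐ x ∂leb c d, p x := by
  obtain ⟨a, -, ha, ha'⟩ := exists_seq_left hcd
  obtain ⟨b, -, hb, hb'⟩ := exists_seq_right hcd
  rw [ae_restrict_iff' (measurableSet_I c d)]
  have : ∀ᵐ x, ∀ n, x ∈ Icc (a n) (b n) → p x := ae_all_iff.2 fun n => by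
    by_cases hn : a n ≤ b n
    · exact h _ (ha n) _ (hb n) hn
    · simp [Icc_eq_empty hn]
  filter_upwards [this] with x hx hxI
  obtain ⟨n, hn⟩ := ((ha' x hxI).and (hb' x hxI)).exists
  exact hx n ⟨hn.1.le, hn.2.le⟩

/-- `f` is integrable on `(c, x)` for every `x ∈ (c, d)`: real-valued version of `LocL1`. -/
def LocIntegrable (c d : EReal) (f : ℝ → ℝ) : Prop :=
  ∀ x ∈ I c d, IntegrableOn f (I c d ∩ Iio x)

/-- `∫_c^x f` for real-valued `f`. -/
noncomputable def prim (c d : EReal) (f : ℝ → ℝ) (x : ℝ) : ℝ := ∫ y in I c d ∩ Iio x, f y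

theorem LocIntegrable.intervalIntegrable {f : ℝ → ℝ} (hf : LocIntegrable c d f) {a b : ℝ}
    (ha : a ∈ I c d) (hb : b ∈ I c d) : IntervalIntegrable f volume a b := by
  wlog hab : a ≤ b
  · exact (this hf hb ha (le_of_not_ge hab)).symm
  rw [intervalIntegrable_iff_integrableOn_Ico_of_le hab]
  exact (hf b hb).mono_set fun x hx => ⟨Icc_subset_I ha hb ⟨hx.1, hx.2.le⟩, hx.2⟩

theorem prim_eq_add {f : ℝ → ℝ} (hf : LocIntegrable c d f) {a b : ℝ}
    (ha : a ∈ I c d) (hb : b ∈ I c d) : prim c d f b = prim c d f a + ∫ t in a..b, f t := by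
  wlog hab : a ≤ b
  · rw [this hf hb ha (le_of_not_ge hab), intervalIntegral.integral_symm a b]; ring
  have hU : I c d ∩ Iio b = (I c d ∩ Iio a) ∪ Ico a b := by
    ext x
    simp only [mem_inter_iff, mem_Iio, mem_union, mem_Ico]
    constructor
    · rintro ⟨h1, h2⟩
      rcases lt_or_ge x a with h | h
      · exact Or.inl ⟨h1, h⟩
      · exact Or.inr ⟨h, h2⟩
    · rintro (⟨h1, h2⟩ | ⟨h1, h2⟩)
      · exact ⟨h1, h2.trans_le hab⟩
      · exact ⟨Icc_subset_I ha hb ⟨h1, h2.le⟩, h2⟩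
  rw [prim, hU, setIntegral_union ?_ measurableSet_Ico (hf a ha)
    ((hf b hb).mono_set (hU ▸ subset_union_right)), intervalIntegral.integral_of_le hab,
    integral_Ico_eq_integral_Ioc, prim]
  exact disjoint_left.2 fun x hx hx' => (not_le.2 hx.2) hx'.1

theorem ac_intervalIntegral {q : ℝ → ℝ}
    (hq : ∀ a ∈ I c d, ∀ b ∈ I c d, IntervalIntegrable q volume a b) {e a b : ℝ}
    (he : e ∈ I c d) (ha : a ∈ I c d) (hb : b ∈ I c d) :
    AbsolutelyContinuousOnInterval (fun x => ∫ t in e..x, q t) a b := by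
  refine ((AbsolutelyContinuousOnInterval.const (∫ t in e..a, q t) a b).add
    ((hq a ha b hb).absolutelyContinuousOnInterval_intervalIntegral
      (c := a) left_mem_uIcc)).congr_uIcc fun x hx => ?_
  exact intervalIntegral.integral_add_adjacent_intervals (hq e he a ha)
    (hq a ha x (uIcc_subset_I ha hb hx))

theorem ae_hasDerivAt_intervalIntegral (hcd : c < d) {q : ℝ → ℝ}
    (hq : ∀ a ∈ I c d, ∀ b ∈ I c d, IntervalIntegrable q volume a b) {e : ℝ} (he : e ∈ I c d) :
    ∀ᵐ x ∂leb c d, HasDerivAt (fun x => ∫ t in e..x, q t) (q x) x := by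
  have hmem : ∀ᵐ x ∂leb c d, x ∈ I c d := ae_restrict_mem (measurableSet_I c d)
  have : ∀ᵐ x ∂leb c d, ∃ a ∈ I c d, HasDerivAt (fun y => ∫ t in a..y, q t) (q x) x := by
    refine ae_leb_of_forall_Icc hcd fun a ha b hb hab => ?_
    filter_upwards [(hq a ha b hb).ae_hasDerivAt_integral] with x hx hx'
    exact ⟨a, ha, hx (Icc_subset_uIcc hx') a left_mem_uIcc⟩
  filter_upwards [this, hmem] with x ⟨a, ha, hx⟩ hxI
  refine (hx.const_add (∫ t in e..a, q t)).congr_of_eventuallyEq ?_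
  filter_upwards [(isOpen_I c d).mem_nhds hxI] with y hy
  exact (intervalIntegral.integral_add_adjacent_intervals (hq e he a ha) (hq a ha y hy)).symm

theorem prim_ac {f : ℝ → ℝ} (hf : LocIntegrable c d f) {a b : ℝ}
    (ha : a ∈ I c d) (hb : b ∈ I c d) : AbsolutelyContinuousOnInterval (prim c d f) a b :=
  ((AbsolutelyContinuousOnInterval.const (prim c d f a) a b).add
    (ac_intervalIntegral (fun _ hx _ hy => hf.intervalIntegrable hx hy) ha ha hb)).congr_uIcc
    fun _ hx => (prim_eq_add hf ha (uIcc_subset_I ha hb hx)).symm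

theorem continuousOn_of_ac {G : ℝ → ℝ}
    (hG : ∀ a ∈ I c d, ∀ b ∈ I c d, AbsolutelyContinuousOnInterval G a b) :
    ContinuousOn G (I c d) := by
  intro x hx
  obtain ⟨a, b, hab, hsub⟩ := mem_nhds_iff_exists_Ioo_subset.1 ((isOpen_I c d).mem_nhds hx)
  obtain ⟨a', ha'⟩ := exists_between hab.1
  obtain ⟨b', hb'⟩ := exists_between hab.2
  have h1 : a' ∈ I c d := hsub ⟨ha'.1, ha'.2.trans hab.2⟩
  have h2 : b' ∈ I c d := hsub ⟨hab.1.trans hb'.1, hb'.2⟩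
  have := (hG a' h1 b' h2).continuousOn
  rw [uIcc_of_le (ha'.2.trans hb'.1).le] at this
  exact (this.continuousAt (Icc_mem_nhds ha'.2 hb'.1)).continuousWithinAt

theorem prim_continuousOn {f : ℝ → ℝ} (hf : LocIntegrable c d f) :
    ContinuousOn (prim c d f) (I c d) :=
  continuousOn_of_ac fun _ ha _ hb => prim_ac hf ha hb

theorem prim_ae_hasDerivAt (hcd : c < d) {f : ℝ → ℝ} (hf : LocIntegrable c d f) :
    ∀ᵐ x ∂leb c d, HasDerivAt (prim c d f) (f x) x := by
  obtain ⟨e, he⟩ := nonempty_I hcd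
  filter_upwards [ae_hasDerivAt_intervalIntegral hcd (fun _ hx _ hy => hf.intervalIntegrable hx hy)
    he, ae_restrict_mem (measurableSet_I c d)] with x hx hxI
  refine (hx.const_add (prim c d f e)).congr_of_eventuallyEq ?_
  filter_upwards [(isOpen_I c d).mem_nhds hxI] with y hy
  exact prim_eq_add hf he hy

theorem prim_tendsto_zero {f : ℝ → ℝ} (hf : LocIntegrable c d f) {a : ℕ → ℝ}
    (ha : Antitone a) (haI : ∀ n, a n ∈ I c d) (hlim : ∀ x ∈ I c d, ∀ᶠ n in atTop, a n < x) :
    Tendsto (fun n => prim c d f (a n)) atTop (𝓝 0) := by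
  have := tendsto_setIntegral_of_antitone (μ := volume) (f := f) (s := fun n => I c d ∩ Iio (a n))
    (fun n => (measurableSet_I c d).inter measurableSet_Iio)
    (fun m n hmn => inter_subset_inter_right _ (Iio_subset_Iio (ha hmn))) ⟨0, hf _ (haI 0)⟩
  have he : ⋂ n, I c d ∩ Iio (a n) = ∅ := by
    refine eq_empty_of_forall_notMem fun x hx => ?_
    rw [mem_iInter] at hx
    obtain ⟨n, hn⟩ := (hlim x (hx 0).1).exists
    exact lt_asymm hn (hx n).2
  simpa [he, prim] using this

/-- A function that is absolutely continuous on compact subintervals and vanishes at `c` is the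
primitive of its derivative. -/
theorem prim_eq_of_ac (hcd : c < d) {f G : ℝ → ℝ} (hf : LocIntegrable c d f)
    (hG : ∀ a ∈ I c d, ∀ b ∈ I c d, AbsolutelyContinuousOnInterval G a b)
    (hd : ∀ᵐ x ∂leb c d, HasDerivAt G (f x) x)
    (hlim : ∀ a : ℕ → ℝ, Antitone a → (∀ n, a n ∈ I c d) →
      (∀ x ∈ I c d, ∀ᶠ n in atTop, a n < x) → Tendsto (fun n => G (a n)) atTop (𝓝 0)) :
    ∀ x ∈ I c d, prim c d f x = G x := by
  obtain ⟨a, ha, haI, ha'⟩ := exists_seq_left hcd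
  intro x hx
  have hn : ∀ n, prim c d f x = prim c d f (a n) + (G x - G (a n)) := fun n => by
    rw [prim_eq_add hf (haI n) hx, ← (hG _ (haI n) _ hx).integral_deriv_eq_sub]
    congr 1
    refine intervalIntegral.integral_congr_ae ?_
    rw [ae_restrict_iff' (measurableSet_I c d)] at hd
    filter_upwards [hd] with y hy hy'
    exact (hy (uIcc_subset_I (haI n) hx (uIoc_subset_uIcc hy'))).deriv.symm
  have h1 := (prim_tendsto_zero hf ha haI ha').add
    (tendsto_const_nhds (x := G x) |>.sub (hlim a ha haI ha'))
  have h2 : Tendsto (fun _ : ℕ => prim c d f x) atTop (𝓝 (0 + (G x - 0))) :=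
    h1.congr fun n => (hn n).symm
  simpa using tendsto_nhds_unique tendsto_const_nhds h2

/-! ### Test functions -/

theorem leb_restrict (c d : EReal) (x : ℝ) :
    (leb c d).restrict (Iio x) = volume.restrict (I c d ∩ Iio x) := by
  rw [leb, Measure.restrict_restrict measurableSet_Iio, inter_comm]

theorem LocIntegrable.congr {f g : ℝ → ℝ} (hf : LocIntegrable c d f) (h : f =ᵐ[leb c d] g) :
    LocIntegrable c d g := fun x hx => by
  have := ae_restrict_of_ae (s := Iio x) h
  rw [leb_restrict] at this
  exact (hf x hx).congr this

theorem LocIntegrable.add {f g : ℝ → ℝ} (hf : LocIntegrable c d f) (hg : LocIntegrable c d g) :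
    LocIntegrable c d (fun x => f x + g x) := fun x hx => (hf x hx).add (hg x hx)

theorem LocIntegrable.aestronglyMeasurable (hcd : c < d) {f : ℝ → ℝ} (hf : LocIntegrable c d f) :
    AEStronglyMeasurable f (leb c d) := by
  obtain ⟨b, -, hb, hb'⟩ := exists_seq_right hcd
  have hU : I c d = ⋃ n, I c d ∩ Iio (b n) := by
    rw [← inter_iUnion, eq_comm, inter_eq_left]
    intro x hx
    obtain ⟨n, hn⟩ := (hb' x hx).exists
    exact mem_iUnion.2 ⟨n, hn⟩
  rw [leb, hU, aestronglyMeasurable_iUnion_iff]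
  exact fun n => (hf _ (hb n)).aestronglyMeasurable

theorem LocIntegrable.mono {f g : ℝ → ℝ} (hf : LocIntegrable c d f)
    (hg : AEStronglyMeasurable g (leb c d)) (h : ∀ᵐ x ∂leb c d, |g x| ≤ |f x|) :
    LocIntegrable c d g := fun x hx => by
  have h1 := ae_restrict_of_ae (s := Iio x) h
  have h2 := hg.restrict (s := Iio x)
  rw [leb_restrict] at h1 h2
  exact Integrable.mono (hf x hx) h2 h1

theorem LocIntegrable.mul_continuousOn (hcd : c < d) {f η : ℝ → ℝ} (hf : LocIntegrable c d f)
    (hη : ContinuousOn η (I c d)) (hb : ∀ x ∈ I c d, |η x| ≤ 1) :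
    LocIntegrable c d (fun x => f x * η x) := by
  refine hf.mono ((hf.aestronglyMeasurable hcd).mul
    (hη.aestronglyMeasurable (measurableSet_I c d))) ?_
  filter_upwards [ae_restrict_mem (measurableSet_I c d)] with x hx
  rw [abs_mul]
  exact mul_le_of_le_one_right (abs_nonneg _) (hb x hx)

/-- `(V η)' = v η + V η'` where `V = ∫_c v`, so that `V η` is the primitive of `v η + V η'`. -/
theorem prim_test (hcd : c < d) {u η η' : ℝ → ℝ} (hu : LocIntegrable c d u)
    (hη : ∀ a ∈ I c d, ∀ b ∈ I c d, AbsolutelyContinuousOnInterval η a b)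
    (hη' : ∀ᵐ x ∂leb c d, HasDerivAt η (η' x) x) (hb : ∀ x ∈ I c d, |η x| ≤ 1)
    (hV : LocIntegrable c d (fun x => prim c d u x * η' x)) :
    LocIntegrable c d (fun x => u x * η x + prim c d u x * η' x) ∧
      ∀ x ∈ I c d, prim c d (fun x => u x * η x + prim c d u x * η' x) x
        = prim c d u x * η x := by
  have hL := (hu.mul_continuousOn hcd (continuousOn_of_ac hη) hb).add hV
  refine ⟨hL, prim_eq_of_ac hcd hL (fun a ha b hb => (prim_ac hu ha hb).mul (hη a ha b hb)) ?_ ?_⟩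
  · filter_upwards [hη', prim_ae_hasDerivAt hcd hu] with x h1 h2
    exact h2.mul h1
  · intro a ha haI hlim
    refine squeeze_zero_norm (fun n => ?_)
      (by simpa using (prim_tendsto_zero hu ha haI hlim).norm)
    rw [norm_mul]
    exact mul_le_of_le_one_right (norm_nonneg _) (hb _ (haI n))

/-- The functions `f` with `|∫_c^x f| ≤ ∫_c^x v` on `(c, d)`: the unit ball of the altered
Cesàro space, for real-valued representatives. -/
def TestBall (c d : EReal) (u : ℝ → ℝ) : Set (ℝ → ℝ) :=
  {f | LocIntegrable c d f ∧ ∀ x ∈ I c d, |prim c d f x| ≤ prim c d u x}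

theorem test_mem (hcd : c < d) {u η η' : ℝ → ℝ} (hu : LocIntegrable c d u)
    (hpos : ∀ x ∈ I c d, 0 < prim c d u x)
    (hη : ∀ a ∈ I c d, ∀ b ∈ I c d, AbsolutelyContinuousOnInterval η a b)
    (hη' : ∀ᵐ x ∂leb c d, HasDerivAt η (η' x) x) (hb : ∀ x ∈ I c d, |η x| ≤ 1)
    (hV : LocIntegrable c d (fun x => prim c d u x * η' x)) :
    (fun x => u x * η x + prim c d u x * η' x) ∈ TestBall c d u := by
  obtain ⟨h1, h2⟩ := prim_test hcd hu hη hη' hb hV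
  refine ⟨h1, fun x hx => ?_⟩
  rw [h2 x hx, abs_mul, abs_of_pos (hpos x hx)]
  exact mul_le_of_le_one_right (hpos x hx).le (hb x hx)

/-- If `∫ |f| |g| < ∞` for all `f` in the unit ball, then `∫ φ |g| < ∞` for every `φ ≥ 0` that is
integrable on each `(c, x)`: with `Ψ' = φ / V`, both `V sin Ψ` and `V cos Ψ` are primitives of elements
`v sin Ψ + φ cos Ψ` and `v cos Ψ - φ sin Ψ` of the ball, and
`φ ≤ |φ cos Ψ| + |φ sin Ψ|`. -/
theorem lintegral_mul_lt_top_of_testBall (hcd : c < d) {u : ℝ → ℝ} (hu : LocIntegrable c d u)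
    (hpos : ∀ x ∈ I c d, 0 < prim c d u x) {g : ℝ → ℝ≥0∞}
    (hg : AEMeasurable g (leb c d))
    (H : ∀ f ∈ TestBall c d u, ∫⁻ x in I c d, ENNReal.ofReal |f x| * g x < ⊤)
    {φ : ℝ → ℝ} (hφ : LocIntegrable c d φ) :
    ∫⁻ x in I c d, ENNReal.ofReal |φ x| * g x < ⊤ := by
  have hV := prim_continuousOn hu
  have hq : ∀ a ∈ I c d, ∀ b ∈ I c d,
      IntervalIntegrable (fun x => φ x * (prim c d u x)⁻¹) volume a b := fun a ha b hb =>
    (hφ.intervalIntegrable ha hb).mul_continuousOn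
      (((hV.mono (uIcc_subset_I ha hb))).inv₀ fun x hx => (hpos x (uIcc_subset_I ha hb hx)).ne')
  obtain ⟨e, he⟩ := nonempty_I hcd
  set Ψ : ℝ → ℝ := fun x => ∫ t in e..x, φ t * (prim c d u t)⁻¹ with hΨ
  have hΨac : ∀ a ∈ I c d, ∀ b ∈ I c d, AbsolutelyContinuousOnInterval Ψ a b :=
    fun a ha b hb => ac_intervalIntegral hq he ha hb
  have hΨd : ∀ᵐ x ∂leb c d, HasDerivAt Ψ (φ x * (prim c d u x)⁻¹) x :=
    ae_hasDerivAt_intervalIntegral hcd hq he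
  have hΨc := continuousOn_of_ac hΨac
  have hmem : ∀ᵐ x ∂leb c d, x ∈ I c d := ae_restrict_mem (measurableSet_I c d)
  have hm : ∀ p : ℝ → ℝ, AEStronglyMeasurable p (leb c d) →
      AEMeasurable (fun x => ENNReal.ofReal |p x| * g x) (leb c d) := fun p hp =>
    hp.norm.aemeasurable.ennreal_ofReal.mul hg
  have hsin : LipschitzWith 1 Real.sin := lipschitzWith_of_nnnorm_deriv_le
    Real.differentiable_sin fun x => by
      rw [Real.deriv_sin, ← NNReal.coe_le_coe, coe_nnnorm]; exact Real.abs_cos_le_one x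
  have hcos : LipschitzWith 1 Real.cos := lipschitzWith_of_nnnorm_deriv_le
    Real.differentiable_cos fun x => by
      rw [Real.deriv_cos', ← NNReal.coe_le_coe, coe_nnnorm, norm_neg]
      exact Real.abs_sin_le_one x
  have key : ∀ s s' : ℝ → ℝ, LipschitzWith 1 s → (∀ y, |s y| ≤ 1) → (∀ y, |s' y| ≤ 1) →
      Continuous s' → (∀ y, HasDerivAt s (s' y) y) →
      ∫⁻ x in I c d, ENNReal.ofReal |φ x * s' (Ψ x)| * g x < ⊤ := by
    intro s s' hs hsb hsb' hsc' hsd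
    have hVη : (fun x => φ x * s' (Ψ x)) =ᵐ[leb c d]
        fun x => prim c d u x * (s' (Ψ x) * (φ x * (prim c d u x)⁻¹)) := by
      filter_upwards [hmem] with x hx
      have := (hpos x hx).ne'
      field_simp
    have hball := test_mem hcd hu hpos (η := fun x => s (Ψ x))
      (η' := fun x => s' (Ψ x) * (φ x * (prim c d u x)⁻¹))
      (fun a ha b hb => (hΨac a ha b hb).lipschitz_comp (hs.lipschitzOnWith))
      (by filter_upwards [hΨd] with x hx using (hsd (Ψ x)).comp x hx)
      (fun x _ => hsb _)
      ((hφ.mul_continuousOn hcd (hsc'.comp_continuousOn hΨc) fun x _ => hsb' _).congr hVη)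
    have hu' : u ∈ TestBall c d u := ⟨hu, fun x hx => (abs_of_pos (hpos x hx)).le⟩
    have hfin := ENNReal.add_lt_top.2 ⟨H _ hball, H u hu'⟩
    refine lt_of_le_of_lt ?_ hfin
    rw [← lintegral_add_right' _ (hm u (hu.aestronglyMeasurable hcd))]
    refine lintegral_mono_ae ?_
    filter_upwards [hVη] with x hx
    rw [← add_mul, ← ENNReal.ofReal_add (abs_nonneg _) (abs_nonneg _), hx]
    gcongr
    have h1 : |u x * s (Ψ x)| ≤ |u x| := by
      rw [abs_mul]; exact mul_le_of_le_one_right (abs_nonneg _) (hsb _)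
    set p := u x * s (Ψ x)
    set q := prim c d u x * (s' (Ψ x) * (φ x * (prim c d u x)⁻¹))
    have h2 : |q| ≤ |p + q| + |p| := by
      have := abs_sub (p + q) p
      rwa [add_sub_cancel_left] at this
    linarith
  have hS := key Real.sin Real.cos hsin Real.abs_sin_le_one Real.abs_cos_le_one
    Real.continuous_cos Real.hasDerivAt_sin
  have hC := key Real.cos (fun y => -Real.sin y) hcos Real.abs_cos_le_one
    (fun y => by rw [abs_neg]; exact Real.abs_sin_le_one y) Real.continuous_sin.neg
    Real.hasDerivAt_cos
  refine lt_of_le_of_lt ?_ (ENNReal.add_lt_top.2 ⟨hS, hC⟩)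
  rw [← lintegral_add_left' (hm (fun x => φ x * Real.cos (Ψ x))
    ((hφ.aestronglyMeasurable hcd).mul ((Real.continuous_cos.comp_continuousOn
      hΨc).aestronglyMeasurable (measurableSet_I c d))))]
  refine lintegral_mono fun x => ?_
  rw [← add_mul, ← ENNReal.ofReal_add (abs_nonneg _) (abs_nonneg _)]
  gcongr
  rw [abs_mul, abs_mul, abs_neg, ← mul_add]
  refine le_mul_of_one_le_right (abs_nonneg _) ?_
  have h1 := Real.sin_sq_add_cos_sq (Ψ x)
  have h2 := Real.abs_cos_le_one (Ψ x)
  have h3 := Real.abs_sin_le_one (Ψ x)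
  rw [← sq_abs, ← sq_abs (Real.cos (Ψ x))] at h1
  -- `1 = cos² + sin² ≤ |cos| + |sin|`
  nlinarith [abs_nonneg (Real.cos (Ψ x)), abs_nonneg (Real.sin (Ψ x))]

/-! ### Boundedness and support of an element of the associate space -/

/-- If `φ |g|` is integrable for all `φ` that are integrable on each `(c, x)`, there is no sequence of
functions with locally finite sum whose integrals against `|g|` are all at least `1`. -/
theorem not_forall_one_le_lintegral (hcd : c < d) {g : ℝ → ℝ≥0∞} (hg : Measurable g)
    (H : ∀ φ : ℝ → ℝ, LocIntegrable c d φ → ∫⁻ x in I c d, ENNReal.ofReal |φ x| * g x < ⊤)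
    {φ : ℕ → ℝ → ℝ≥0∞} (hφ : ∀ n, Measurable (φ n))
    (hfin : ∀ x ∈ I c d, ∑' n, ∫⁻ y in I c d ∩ Iio x, φ n y < ⊤) :
    ¬ ∀ n, 1 ≤ ∫⁻ x in I c d, φ n x * g x := by
  intro h1
  have hΦm : Measurable fun y => ∑' n, φ n y := Measurable.tsum hφ
  have hΦ : ∀ x ∈ I c d, ∫⁻ y in I c d ∩ Iio x, ∑' n, φ n y ≠ ⊤ := fun x hx => by
    rw [lintegral_tsum fun n => (hφ n).aemeasurable]
    exact (hfin x hx).ne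
  have hae : ∀ᵐ y ∂leb c d, ∑' n, φ n y < ⊤ := by
    refine ae_leb_of_forall_Icc hcd fun a ha b hb hab => ?_
    have hIco : ∀ᵐ y, y ∈ I c d ∩ Iio b → ∑' n, φ n y < ⊤ := by
      rw [← ae_restrict_iff' ((measurableSet_I c d).inter measurableSet_Iio)]
      exact ae_lt_top hΦm (hΦ b hb)
    filter_upwards [hIco, (measure_eq_zero_iff_ae_notMem (μ := volume)).1
      (Real.volume_singleton (a := b))] with y hy hyb hy'
    exact hy ⟨Icc_subset_I ha hb hy', lt_of_le_of_ne hy'.2 hyb⟩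
  have hL : LocIntegrable c d fun y => (∑' n, φ n y).toReal := fun x hx =>
    integrable_toReal_of_lintegral_ne_top hΦm.aemeasurable (hΦ x hx)
  refine (H _ hL).ne ?_
  have : ∫⁻ x in I c d, ENNReal.ofReal |(∑' n, φ n x).toReal| * g x
      = ∑' n, ∫⁻ x in I c d, φ n x * g x := by
    rw [← lintegral_tsum (f := fun n x => φ n x * g x) fun n => ((hφ n).mul hg).aemeasurable]
    refine lintegral_congr_ae ?_
    filter_upwards [hae] with x hx
    rw [abs_of_nonneg ENNReal.toReal_nonneg, ENNReal.ofReal_toReal hx.ne, ENNReal.tsum_mul_right]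
  rw [this]
  exact top_le_iff.1 ((ENNReal.tsum_const_eq_top_of_ne_zero one_ne_zero).symm.le.trans
    (ENNReal.tsum_le_tsum h1))

/-- If `g` is unbounded, the `φₙ` are indicators of subsets of `{g > 2ⁿ}`, normalised to have
integral `2⁻ⁿ`. -/
theorem essSup_lt_top_of_lintegral (hcd : c < d) {g : ℝ → ℝ≥0∞} (hg : Measurable g)
    (H : ∀ φ : ℝ → ℝ, LocIntegrable c d φ → ∫⁻ x in I c d, ENNReal.ofReal |φ x| * g x < ⊤) :
    essSup g (leb c d) < ⊤ := by
  by_contra hcon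
  have hT : ∀ n : ℕ, 0 < leb c d {x | (2 : ℝ≥0∞) ^ n < g x} := fun n => by
    refine pos_iff_ne_zero.2 fun h0 => hcon ?_
    have : ∀ᵐ x ∂leb c d, g x ≤ 2 ^ n := by
      rw [ae_iff]; simpa using h0
    exact (essSup_le_of_ae_le _ this).trans_lt (by finiteness)
  have hE : ∀ n : ℕ, ∃ E, MeasurableSet E ∧ E ⊆ {x | (2 : ℝ≥0∞) ^ n < g x} ∧
      0 < leb c d E ∧ leb c d E < ⊤ := fun n =>
    Measure.exists_subset_measure_lt_top (measurableSet_lt measurable_const hg) (hT n)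
  choose E hEm hEs hE0 hEt using hE
  refine not_forall_one_le_lintegral hcd hg H
    (φ := fun n => (E n).indicator fun _ => (2 ^ n)⁻¹ * (leb c d (E n))⁻¹)
    (fun n => measurable_const.indicator (hEm n)) (fun x hx => ?_) fun n => ?_
  · refine lt_of_le_of_lt (ENNReal.tsum_le_tsum (g := fun n : ℕ => (2⁻¹ : ℝ≥0∞) ^ n) fun n => ?_) ?_
    · refine (lintegral_mono_set inter_subset_left).trans ?_
      rw [lintegral_indicator_const (hEm n), mul_assoc, ENNReal.inv_mul_cancel (hE0 n).ne'
        (hEt n).ne, mul_one, ENNReal.inv_pow]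
    · rw [ENNReal.tsum_geometric, ENNReal.one_sub_inv_two, inv_inv]
      finiteness
  · calc (1 : ℝ≥0∞) = ((2 ^ n)⁻¹ * (leb c d (E n))⁻¹ * 2 ^ n) * leb c d (E n) := by
          rw [mul_right_comm ((2 : ℝ≥0∞) ^ n)⁻¹, ENNReal.inv_mul_cancel (by positivity)
            (by finiteness), one_mul, ENNReal.inv_mul_cancel (hE0 n).ne' (hEt n).ne]
      _ = ∫⁻ x in I c d, (E n).indicator (fun _ => (2 ^ n)⁻¹ * (leb c d (E n))⁻¹ * 2 ^ n) x :=
          (lintegral_indicator_const (hEm n) _).symm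
      _ ≤ _ := by
          refine lintegral_mono fun x => ?_
          by_cases hx : x ∈ E n
          · simp only [indicator_of_mem hx]
            gcongr
            exact (hEs n hx).le
          · simp [indicator_of_notMem hx]

/-- If `g` does not vanish near `d`, the `φₙ` are multiples of indicators of sets moving off
to `d`. -/
theorem exists_ae_eq_zero_of_lintegral (hcd : c < d) {g : ℝ → ℝ≥0∞} (hg : Measurable g)
    (H : ∀ φ : ℝ → ℝ, LocIntegrable c d φ → ∫⁻ x in I c d, ENNReal.ofReal |φ x| * g x < ⊤) :
    ∃ b ∈ I c d, ∀ᵐ x ∂leb c d, b < x → g x = 0 := by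
  by_contra! hcon
  have hbd := essSup_lt_top_of_lintegral hcd hg H
  obtain ⟨b, hbm, hb, hb'⟩ := exists_seq_right hcd
  have hTm : ∀ n, MeasurableSet (Ioi (b n) ∩ {x | g x ≠ 0}) := fun n =>
    measurableSet_Ioi.inter (hg (measurableSet_singleton 0).compl)
  have hT : ∀ n, 0 < leb c d (Ioi (b n) ∩ {x | g x ≠ 0}) := fun n => by
    refine pos_iff_ne_zero.2 fun h0 => hcon _ (hb n) ?_
    filter_upwards [measure_eq_zero_iff_ae_notMem.1 h0] with x hx hbx
    exact hx hbx
  choose E hEm hEs hE0 hEt using fun n => Measure.exists_subset_measure_lt_top (hTm n) (hT n)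
  have hα0 : ∀ n, ∫⁻ x in E n, g x ∂leb c d ≠ 0 := fun n h0 => by
    rw [lintegral_eq_zero_iff hg, EventuallyEq, ae_restrict_iff' (hEm n)] at h0
    refine (hE0 n).ne' (measure_eq_zero_iff_ae_notMem.2 ?_)
    filter_upwards [h0] with x hx hxE
    exact (hEs n hxE).2 (hx hxE)
  have hαt : ∀ n, ∫⁻ x in E n, g x ∂leb c d ≠ ⊤ := fun n => by
    refine (lt_of_le_of_lt (lintegral_mono_ae (ae_restrict_of_ae ae_le_essSup)) ?_).ne
    rw [setLIntegral_const]
    exact ENNReal.mul_lt_top hbd (hEt n)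
  refine not_forall_one_le_lintegral hcd hg H
    (φ := fun n => (E n).indicator fun _ => (∫⁻ x in E n, g x ∂leb c d)⁻¹)
    (fun n => measurable_const.indicator (hEm n)) (fun x hx => ?_) fun n => ?_
  -- only the finitely many `n` with `b n < x` contribute on `(c, x)`
  · obtain ⟨N, hN⟩ := (hb' x hx).exists
    rw [tsum_eq_sum (s := Finset.range N)]
    · refine ENNReal.sum_lt_top.2 fun n _ => ?_
      refine (lintegral_mono_set inter_subset_left).trans_lt ?_
      rw [lintegral_indicator_const (hEm n)]
      exact ENNReal.mul_lt_top (ENNReal.inv_lt_top.2 (pos_iff_ne_zero.2 (hα0 n))) (hEt n)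
    · intro n hn
      rw [Finset.mem_range, not_lt] at hn
      rw [setLIntegral_congr_fun (g := fun _ => 0) ((measurableSet_I c d).inter measurableSet_Iio),
        lintegral_zero]
      intro y hy
      refine indicator_of_notMem (fun hyE => ?_) _
      exact lt_asymm (hN.trans_le (hbm hn)) ((hEs n hyE).1.trans hy.2)
  · have : ∀ x, (E n).indicator (fun _ => (∫⁻ x in E n, g x ∂leb c d)⁻¹) x * g x
        = (E n).indicator (fun x => (∫⁻ x in E n, g x ∂leb c d)⁻¹ * g x) x := fun x => by
      by_cases hx : x ∈ E n <;> simp [hx]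
    simp only [this]
    rw [lintegral_indicator (hEm n), lintegral_const_mul _ hg,
      ENNReal.inv_mul_cancel (hα0 n) (hαt n)]

/-! ### Functions whose distributional derivative is a finite measure -/

/-- The piecewise affine function `t ↦ ∫_{-∞}^t 1_{(0, ε]}`. -/
noncomputable def ramp (ε t : ℝ) : ℝ := max 0 (min t ε)

theorem ramp_nonneg (ε t : ℝ) : 0 ≤ ramp ε t := le_max_left _ _

theorem ramp_le {ε : ℝ} (hε : 0 < ε) (t : ℝ) : ramp ε t ≤ ε := max_le hε.le (min_le_right _ _)

theorem ramp_mono (ε : ℝ) : Monotone (ramp ε) := fun _ _ h =>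
  max_le_max le_rfl (min_le_min h le_rfl)

theorem lipschitz_ramp_sub (ε p : ℝ) : LipschitzWith 1 fun x => ramp ε (x - p) :=
  ((((LipschitzWith.id (α := ℝ)).sub (LipschitzWith.const p)).min_const ε).const_max 0).weaken
    (by simp)

theorem hasDerivAt_ramp_sub {ε : ℝ} (hε : 0 < ε) {p x : ℝ} (h1 : x ≠ p) (h2 : x ≠ p + ε) :
    HasDerivAt (fun x => ramp ε (x - p)) ((Ioc p (p + ε)).indicator 1 x) x := by
  rcases lt_or_gt_of_ne h1 with h | h
  · rw [indicator_of_notMem fun hx => lt_asymm h hx.1]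
    refine (hasDerivAt_const x (0 : ℝ)).congr_of_eventuallyEq ?_
    filter_upwards [Iio_mem_nhds h] with y hy
    have : y < p := hy
    rw [ramp, min_eq_left (by linarith), max_eq_left (by linarith)]
  rcases lt_or_gt_of_ne h2 with h' | h'
  · rw [indicator_of_mem (show x ∈ Ioc p (p + ε) from ⟨h, h'.le⟩)]
    refine ((hasDerivAt_id x).sub_const p).congr_of_eventuallyEq ?_
    filter_upwards [Ioo_mem_nhds h h'] with y hy
    have h3 := hy.1
    have h4 := hy.2
    rw [ramp, min_eq_left (by linarith), max_eq_right (by linarith)]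
    rfl
  · rw [indicator_of_notMem fun hx => not_le.2 h' hx.2]
    refine (hasDerivAt_const x ε).congr_of_eventuallyEq ?_
    filter_upwards [Ioi_mem_nhds h'] with y hy
    have : p + ε < y := hy
    rw [ramp, min_eq_right (by linarith), max_eq_right hε.le]

/-- `|∫ H η'| ≤ M` for all absolutely continuous `η` with values in `[-1, 1]` and bounded,
compactly supported derivative: the derivative of `H` in the sense of distributions is a measure
of total variation at most `M`. -/
def WeakVariationLE (c d : EReal) (H : ℝ → ℝ) (M : ℝ) : Prop :=
  ∀ η η' : ℝ → ℝ, (∀ a ∈ I c d, ∀ b ∈ I c d, AbsolutelyContinuousOnInterval η a b) →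
    (∀ᵐ x ∂leb c d, HasDerivAt η (η' x) x) → (∀ x ∈ I c d, |η x| ≤ 1) →
    Measurable η' → (∃ C, ∀ x, |η' x| ≤ C) →
    (∃ α ∈ I c d, ∃ β ∈ I c d, ∀ x, x ∉ Icc α β → η' x = 0) →
    |∫ x in I c d, H x * η' x| ≤ M

theorem ae_ne_leb (c d : EReal) (p : ℝ) : ∀ᵐ x ∂leb c d, x ≠ p :=
  ae_restrict_of_ae ((measure_eq_zero_iff_ae_notMem (μ := volume)).1 Real.volume_singleton)

/-- The step function `η' = ε⁻¹ ∑ σᵢ (1_{(xᵢ₊₁, xᵢ₊₁ + ε]} - 1_{(xᵢ, xᵢ + ε]})` with signs `σᵢ` has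
a primitive with values in `[-1, 1]`; testing with it bounds the variation of the averages. -/
theorem eVariationOn_average_le {H : ℝ → ℝ} {M : ℝ}
    (hH : ∀ a ∈ I c d, ∀ b ∈ I c d, IntervalIntegrable H volume a b)
    (hM : WeakVariationLE c d H M) {ε : ℝ} (hε : 0 < ε) :
    eVariationOn (fun x => ε⁻¹ * ∫ t in x..x + ε, H t) {x | x ∈ I c d ∧ x + ε ∈ I c d}
      ≤ ENNReal.ofReal M := by
  refine iSup_le fun ⟨n, x, hxm, hx⟩ => ?_
  dsimp only
  set A : ℕ → ℝ := fun i => ∫ t in x i..x i + ε, H t with hA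
  set D : ℕ → ℝ → ℝ := fun i => (Ioc (x i) (x i + ε)).indicator 1 with hD
  set σ : ℕ → ℝ := fun i => if 0 ≤ A (i + 1) - A i then 1 else -1 with hσ
  have hσ1 : ∀ i, |σ i| = 1 := fun i => by
    simp only [hσ]; split_ifs <;> simp
  have hσA : ∀ i, |A (i + 1) - A i| = σ i * (A (i + 1) - A i) := fun i => by
    simp only [hσ]; split_ifs with h
    · rw [abs_of_nonneg h, one_mul]
    · rw [abs_of_neg (not_le.1 h), neg_one_mul]
  set η : ℝ → ℝ := fun y =>
    ∑ i ∈ Finset.range n, σ i * ε⁻¹ * (ramp ε (y - x (i + 1)) - ramp ε (y - x i)) with hη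
  set η' : ℝ → ℝ := fun y => ∑ i ∈ Finset.range n, σ i * ε⁻¹ * (D (i + 1) y - D i y) with hη'
  have hsub : ∀ i, Ioc (x i) (x i + ε) ⊆ I c d := fun i =>
    Ioc_subset_Icc_self.trans (Icc_subset_I (hx i).1 (hx i).2)
  have hII : ∀ i, IntegrableOn (fun y => H y * D i y) (I c d) := fun i => by
    have h1 : (fun y => H y * D i y) = (Ioc (x i) (x i + ε)).indicator H := by
      ext y; by_cases hy : y ∈ Ioc (x i) (x i + ε) <;> simp [hD, hy]
    rw [h1, IntegrableOn, integrable_indicator_iff measurableSet_Ioc, IntegrableOn,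
      Measure.restrict_restrict measurableSet_Ioc, inter_eq_left.2 (hsub i)]
    exact (intervalIntegrable_iff_integrableOn_Ioc_of_le (by linarith)).1
      (hH _ (hx i).1 _ (hx i).2)
  have hIA : ∀ i, ∫ y in I c d, H y * D i y = A i := fun i => by
    have h1 : (fun y => H y * D i y) = (Ioc (x i) (x i + ε)).indicator H := by
      ext y; by_cases hy : y ∈ Ioc (x i) (x i + ε) <;> simp [hD, hy]
    rw [h1, setIntegral_indicator measurableSet_Ioc, inter_eq_right.2 (hsub i), hA]
    exact (intervalIntegral.integral_of_le (by linarith)).symm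
  have hint : ∫ y in I c d, H y * η' y
      = ∑ i ∈ Finset.range n, σ i * ε⁻¹ * (A (i + 1) - A i) := by
    have h1 : ∀ y, H y * η' y = ∑ i ∈ Finset.range n,
        σ i * ε⁻¹ * (H y * D (i + 1) y - H y * D i y) := fun y => by
      rw [hη', Finset.mul_sum]
      exact Finset.sum_congr rfl fun i _ => by ring
    simp only [h1]
    rw [integral_finsetSum _ fun i _ => Integrable.const_mul
      (f := fun y => H y * D (i + 1) y - H y * D i y) ((hII (i + 1)).sub (hII i)) _]
    refine Finset.sum_congr rfl fun i _ => ?_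
    rw [integral_const_mul, integral_sub (hII _) (hII _), hIA, hIA]
  have hbound := hM η η' ?_ ?_ ?_ ?_ ?_ ?_
  · calc ∑ i ∈ Finset.range n, edist (ε⁻¹ * ∫ t in x (i + 1)..x (i + 1) + ε, H t)
          (ε⁻¹ * ∫ t in x i..x i + ε, H t)
        = ∑ i ∈ Finset.range n, ENNReal.ofReal (σ i * ε⁻¹ * (A (i + 1) - A i)) := by
          refine Finset.sum_congr rfl fun i _ => ?_
          rw [edist_dist, Real.dist_eq, ← mul_sub, abs_mul, abs_of_pos (inv_pos.2 hε)]
          change ENNReal.ofReal (ε⁻¹ * |A (i + 1) - A i|) = _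
          rw [hσA]; ring_nf
      _ = ENNReal.ofReal (∑ i ∈ Finset.range n, σ i * ε⁻¹ * (A (i + 1) - A i)) := by
          refine (ENNReal.ofReal_sum_of_nonneg fun i _ => ?_).symm
          have := hσA i
          have h2 : σ i * ε⁻¹ * (A (i + 1) - A i) = ε⁻¹ * |A (i + 1) - A i| := by
            rw [this]; ring
          rw [h2]; positivity
      _ ≤ ENNReal.ofReal M :=
          ENNReal.ofReal_le_ofReal (hint ▸ (le_abs_self _).trans hbound)
  · intro a _ b _
    refine AbsolutelyContinuousOnInterval.sum _ fun i _ => ?_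
    exact (((lipschitz_ramp_sub ε _).lipschitzOnWith.absolutelyContinuousOnInterval).sub
      ((lipschitz_ramp_sub ε _).lipschitzOnWith.absolutelyContinuousOnInterval)).const_mul _
  · have h1 : ∀ᵐ y ∂leb c d, ∀ i, y ≠ x i ∧ y ≠ x i + ε :=
      ae_all_iff.2 fun i => (ae_ne_leb c d _).and (ae_ne_leb c d _)
    filter_upwards [h1] with y hy
    refine HasDerivAt.fun_sum fun i _ => HasDerivAt.const_mul _ (HasDerivAt.sub ?_ ?_)
    · exact hasDerivAt_ramp_sub hε (hy _).1 (hy _).2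
    · exact hasDerivAt_ramp_sub hε (hy _).1 (hy _).2
  · intro y _
    calc |η y| ≤ ∑ i ∈ Finset.range n,
          |σ i * ε⁻¹ * (ramp ε (y - x (i + 1)) - ramp ε (y - x i))| :=
          Finset.abs_sum_le_sum_abs _ _
      _ = ∑ i ∈ Finset.range n, ε⁻¹ * (ramp ε (y - x i) - ramp ε (y - x (i + 1))) := by
          refine Finset.sum_congr rfl fun i _ => ?_
          rw [abs_mul, abs_mul, hσ1, one_mul, abs_of_pos (inv_pos.2 hε), abs_sub_comm,
            abs_of_nonneg]
          exact sub_nonneg.2 (ramp_mono ε (by linarith [hxm (Nat.le_succ i)]))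
      _ = ε⁻¹ * (ramp ε (y - x 0) - ramp ε (y - x n)) := by
          rw [← Finset.mul_sum, Finset.sum_range_sub' fun i => ramp ε (y - x i)]
      _ ≤ ε⁻¹ * ε := by
          gcongr
          linarith [ramp_le hε (y - x 0), ramp_nonneg ε (y - x n)]
      _ = 1 := inv_mul_cancel₀ hε.ne'
  · refine Finset.measurable_fun_sum _ fun i _ => ?_
    have hm : ∀ i, Measurable (D i) := fun i => measurable_one.indicator measurableSet_Ioc
    exact ((hm _).sub (hm _)).const_mul _
  · refine ⟨∑ i ∈ Finset.range n, ε⁻¹, fun y => (Finset.abs_sum_le_sum_abs _ _).trans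
      (Finset.sum_le_sum fun i _ => ?_)⟩
    rw [abs_mul, abs_mul, hσ1, one_mul, abs_of_pos (inv_pos.2 hε)]
    refine mul_le_of_le_one_right (by positivity) ?_
    have hd : ∀ i, 0 ≤ D i y ∧ D i y ≤ 1 := fun i => by
      by_cases hy : y ∈ Ioc (x i) (x i + ε) <;> simp [hD, hy]
    rw [abs_le]
    constructor <;> linarith [(hd i).1, (hd i).2, (hd (i + 1)).1, (hd (i + 1)).2]
  · refine ⟨x 0, (hx 0).1, x n + ε, (hx n).2, fun y hy => Finset.sum_eq_zero fun i hi => ?_⟩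
    have hz : ∀ j, j ≤ n → D j y = 0 := fun j hj => by
      refine indicator_of_notMem (fun h => hy ⟨?_, ?_⟩) _
      · exact (hxm (Nat.zero_le j)).trans h.1.le
      · linarith [h.2, hxm hj]
    rw [hz _ (Finset.mem_range.1 hi), hz _ (Finset.mem_range.1 hi).le]
    ring

/-- The averages over `(x, x + ε)` converge to the right derivative of the primitive as `ε → 0`,
and the variation is lower semicontinuous. -/
theorem eVariationOn_le_of_hasDerivWithinAt {H k : ℝ → ℝ} {M : ℝ}
    (hH : ∀ a ∈ I c d, ∀ b ∈ I c d, IntervalIntegrable H volume a b)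
    (hM : WeakVariationLE c d H M) {e : ℝ} (he : e ∈ I c d) {S : Set ℝ} (hS : S ⊆ I c d)
    (hk : ∀ x ∈ S, HasDerivWithinAt (fun y => ∫ t in e..y, H t) (k x) (Ioi x) x) :
    eVariationOn k S ≤ ENNReal.ofReal M := by
  have hlim : ∀ x ∈ S, Tendsto (fun ε => ε⁻¹ * ∫ t in x..x + ε, H t) (𝓝[>] 0) (𝓝 (k x)) := by
    intro x hx
    have h1 := (hasDerivWithinAt_iff_tendsto_slope' (self_notMem_Ioi)).1 (hk x hx)
    have h2 : Tendsto (fun ε => x + ε) (𝓝[>] 0) (𝓝[>] x) := by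
      refine tendsto_nhdsWithin_iff.2 ⟨?_, ?_⟩
      · have : Tendsto (fun ε => x + ε) (𝓝 0) (𝓝 (x + 0)) :=
          (continuous_const.add continuous_id).tendsto 0
        rw [add_zero] at this
        exact this.mono_left nhdsWithin_le_nhds
      · filter_upwards [self_mem_nhdsWithin] with ε hε
        exact lt_add_of_pos_right x hε
    have h3 : ∀ᶠ ε in 𝓝[>] (0 : ℝ), x + ε ∈ I c d :=
      h2.eventually (nhdsWithin_le_nhds ((isOpen_I c d).mem_nhds (hS hx)))
    refine (h1.comp h2).congr' ?_
    filter_upwards [h3] with ε hε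
    rw [Function.comp_apply, slope_def_field, add_sub_cancel_left, div_eq_inv_mul,
      intervalIntegral.integral_interval_sub_left (hH _ he _ hε) (hH _ he _ (hS hx))]
  by_contra! hlt
  rw [eVariationOn.eq_biSup_inter_Icc] at hlt
  simp only [lt_iSup_iff] at hlt
  obtain ⟨p, hp, hlt⟩ := hlt
  have h1 := eVariationOn.lowerSemicontinuous_aux
    (fun x hx => hlim x (inter_subset_left hx)) hlt
  have h2 : ∀ᶠ ε in 𝓝[>] (0 : ℝ), p.2 + ε ∈ I c d := by
    have h3 : Tendsto (fun ε => p.2 + ε) (𝓝 0) (𝓝 (p.2 + 0)) :=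
      (continuous_const.add continuous_id).tendsto 0
    rw [add_zero] at h3
    exact nhdsWithin_le_nhds (h3.eventually ((isOpen_I c d).mem_nhds (hS hp.2.1)))
  obtain ⟨ε, h1, h2, hε⟩ := (h1.and (h2.and self_mem_nhdsWithin)).exists
  refine (h1.trans_le (eVariationOn.mono _ ?_)).not_ge (eVariationOn_average_le hH hM hε)
  intro x hx
  have hε' : 0 < ε := hε
  exact ⟨hS hx.1, Icc_subset_I (hS hx.1) h2 ⟨by linarith, by linarith [hx.2.2]⟩⟩

theorem _root_.BoundedVariationOn.fun_sub {p q : ℝ → ℝ} {S : Set ℝ} (hp : BoundedVariationOn p S)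
    (hq : BoundedVariationOn q S) : BoundedVariationOn (fun x => p x - q x) S := by
  refine (lt_of_le_of_lt (iSup_le fun u => ?_) (ENNReal.add_lt_top.2 ⟨hp.lt_top, hq.lt_top⟩)).ne
  refine le_trans (Finset.sum_le_sum fun i _ => (?_ : _ ≤
    edist (p (u.2.1 (i + 1))) (p (u.2.1 i)) + edist (q (u.2.1 (i + 1))) (q (u.2.1 i)))) ?_
  · simp only [edist_dist, ← ENNReal.ofReal_add dist_nonneg dist_nonneg]
    exact ENNReal.ofReal_le_ofReal (dist_sub_sub_le _ _ _ _)
  rw [Finset.sum_add_distrib]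
  exact add_le_add (eVariationOn.sum_le u.2.2.1 u.2.2.2) (eVariationOn.sum_le u.2.2.1 u.2.2.2)

/-- A function of bounded variation on a set is a difference of bounded monotone functions, each
of which extends to the line. -/
theorem _root_.BoundedVariationOn.exists_extension {f : ℝ → ℝ} {S : Set ℝ}
    (hf : BoundedVariationOn f S) : ∃ h : ℝ → ℝ, BoundedVariationOn h univ ∧ EqOn f h S := by
  rcases S.eq_empty_or_nonempty with rfl | ⟨s, hs⟩
  · refine ⟨fun _ => 0, ?_, eqOn_empty _ _⟩
    have : eVariationOn (fun _ : ℝ => (0 : ℝ)) univ = 0 :=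
      eVariationOn.constant_on (by rintro _ ⟨_, _, rfl⟩ _ ⟨_, _, rfl⟩; rfl)
    rw [BoundedVariationOn, this]
    exact ENNReal.zero_ne_top
  have ext : ∀ p : ℝ → ℝ, MonotoneOn p S → ∀ C, (∀ x ∈ S, |p x| ≤ C) →
      ∃ q : ℝ → ℝ, BoundedVariationOn q univ ∧ EqOn p q S := by
    intro p hp C hC
    obtain ⟨q, hq, hpq⟩ := hp.exists_monotone_extension
      ⟨-C, by rintro _ ⟨x, hx, rfl⟩; exact (abs_le.1 (hC x hx)).1⟩
      ⟨C, by rintro _ ⟨x, hx, rfl⟩; exact (abs_le.1 (hC x hx)).2⟩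
    have hC0 : 0 ≤ C := (abs_nonneg _).trans (hC s hs)
    refine ⟨fun x => max (-C) (min (q x) C), ?_, fun x hx => ?_⟩
    · refine MonotoneOn.boundedVariationOn (C := C) (fun x _ y _ hxy => ?_) fun x _ => ?_
      · exact max_le_max le_rfl (min_le_min (hq hxy) le_rfl)
      · exact abs_le.2 ⟨le_max_left _ _, max_le (by linarith) (min_le_right _ _)⟩
    · have := abs_le.1 (hC x hx)
      rw [hpq hx] at this
      dsimp only
      rw [min_eq_left this.2, max_eq_right this.1, hpq hx]
  have hl := hf.locallyBoundedVariationOn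
  have hC1 : ∀ x, |variationOnFromTo f S s x| ≤ (eVariationOn f S).toReal := fun x =>
    variationOnFromTo.abs_le_eVariationOn hf
  obtain ⟨p, hp, hp'⟩ := ext (variationOnFromTo f S s) (variationOnFromTo.monotoneOn hl hs) _
    fun x _ => hC1 x
  obtain ⟨q, hq, hq'⟩ := ext (variationOnFromTo f S s - f)
    (variationOnFromTo.sub_self_monotoneOn hl hs)
    ((eVariationOn f S).toReal + ((eVariationOn f S).toReal + |f s|)) fun x hx => by
      rw [Pi.sub_apply]
      refine (abs_sub _ _).trans (add_le_add (hC1 x) ?_)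
      have h1 := hf.dist_le hx hs
      rw [Real.dist_eq] at h1
      have h2 := abs_add_le (f x - f s) (f s)
      rw [sub_add_cancel] at h2
      linarith
  refine ⟨fun x => p x - q x, hp.fun_sub hq, fun x hx => ?_⟩
  have h1 := hp' hx
  have h2 := hq' hx
  rw [Pi.sub_apply] at h2
  dsimp only
  linarith

/-- By Lebesgue's differentiation theorem, `H` itself has bounded variation on a set of full
measure. -/
theorem exists_boundedVariationOn_ae_eq (hcd : c < d) {H : ℝ → ℝ} {M : ℝ}
    (hH : ∀ a ∈ I c d, ∀ b ∈ I c d, IntervalIntegrable H volume a b)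
    (hM : WeakVariationLE c d H M) :
    ∃ h : ℝ → ℝ, BoundedVariationOn h (I c d) ∧ H =ᵐ[leb c d] h := by
  obtain ⟨e, he⟩ := nonempty_I hcd
  set S := {x | x ∈ I c d ∧ HasDerivAt (fun y => ∫ t in e..y, H t) (H x) x}
  have hv : BoundedVariationOn H S :=
    ((eVariationOn_le_of_hasDerivWithinAt hH hM he (S := S) (fun x hx => hx.1)
      fun x hx => hx.2.hasDerivWithinAt).trans_lt ENNReal.ofReal_lt_top).ne
  obtain ⟨h, hh, hHh⟩ := hv.exists_extension
  refine ⟨h, hh.mono (subset_univ _), ?_⟩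
  filter_upwards [ae_restrict_mem (measurableSet_I c d),
    ae_hasDerivAt_intervalIntegral hcd hH he] with x hx hx'
  exact hHh ⟨hx, hx'⟩

/-- The averages of `H` over `(x, x + ε)` converge, at every `x`, to the right limit of any
function of which `H` is an a.e. representative. -/
theorem eVariationOn_rightLim_le_of_weakVariationLE (hcd : c < d) {H h k : ℝ → ℝ} {M : ℝ}
    (hH : ∀ a ∈ I c d, ∀ b ∈ I c d, IntervalIntegrable H volume a b)
    (hM : WeakVariationLE c d H M) (hHh : H =ᵐ[leb c d] h)
    (hk : ∀ x ∈ I c d, Tendsto h (𝓝[>] x) (𝓝 (k x))) :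
    eVariationOn k (I c d) ≤ ENNReal.ofReal M := by
  obtain ⟨e, he⟩ := nonempty_I hcd
  refine eVariationOn_le_of_hasDerivWithinAt hH hM he Subset.rfl fun x hx => ?_
  obtain ⟨b, hb⟩ : ∃ b ∈ I c d, x < b := by
    obtain ⟨b, -, hb, hb'⟩ := exists_seq_right hcd
    obtain ⟨n, hn⟩ := (hb' x hx).exists
    exact ⟨b n, hb n, hn⟩
  refine (intervalIntegral.integral_hasDerivWithinAt_of_tendsto_ae_right (s := Ici x) (t := Ioi x)
    (hH e he x hx) ?_ ?_).mono Ioi_subset_Ici_self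
  · have := (hH x hx b hb.1).1.aestronglyMeasurable
    exact ⟨Ioc x b, Ioc_mem_nhdsGT hb.2, this⟩
  · refine ((hk x hx).mono_left inf_le_left).congr' ?_
    have h1 : ∀ᵐ y, y ∈ I c d → h y = H y := by
      rw [← ae_restrict_iff' (measurableSet_I c d)]
      exact hHh.symm
    rw [EventuallyEq]
    have h2 : ∀ᶠ y in 𝓝[>] x, y ∈ I c d := nhdsWithin_le_nhds ((isOpen_I c d).mem_nhds hx)
    filter_upwards [mem_inf_of_left h2, mem_inf_of_right h1] with y h3 h4 using h4 h3

end AltCesaro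

/-! ### The Lebesgue–Stieltjes measure of a function of bounded variation -/

/-- The measure of a function `f` of bounded variation is dominated by the Stieltjes measure of the
variation function of its right limit. -/
theorem BoundedVariationOn.variation_vectorMeasure_univ_le {α E : Type*} [LinearOrder α]
    [DenselyOrdered α] [TopologicalSpace α] [OrderTopology α] [SecondCountableTopology α]
    [CompactIccSpace α] [hα : MeasurableSpace α] [BorelSpace α] [NoMinOrder α]
    [NormedAddCommGroup E] [CompleteSpace E] {f : α → E} (hf : BoundedVariationOn f univ) :
    hf.vectorMeasure.variation univ ≤ eVariationOn f.rightLim univ := by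
  rcases isEmpty_or_nonempty α with h'α | h'α
  · rw [Set.univ_eq_empty_iff.2 h'α, measure_empty]; exact zero_le
  obtain ⟨u, u_anti, hu⟩ : ∃ u : ℕ → α, Antitone u ∧ Tendsto u atTop atBot :=
    exists_seq_antitone_tendsto_atTop_atBot α
  obtain ⟨w, w_mono, hw⟩ : ∃ w : ℕ → α, Monotone w ∧ Tendsto w atTop atTop :=
    exists_seq_monotone_tendsto_atTop_atTop α
  have hmono : Monotone fun n => Ioc (u n) (w n) := fun i j hij =>
    Ioc_subset_Ioc (u_anti hij) (w_mono hij)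
  have hU : ⋃ n, Ioc (u n) (w n) = univ := by
    refine eq_univ_of_forall fun x => mem_iUnion.2 ?_
    exact ((hu.eventually (Iio_mem_atBot x)).and (hw.eventually (Ici_mem_atTop x))).exists
  have x₀ : α := h'α.some
  set ν := (hf.stieltjesFunctionRightLim x₀).measure with hν
  have : IsFiniteMeasure ν := StieltjesFunction.isFiniteMeasure_of_forall_abs_le
    (C := (eVariationOn f.rightLim univ).toReal) _
    fun x => variationOnFromTo.abs_le_eVariationOn hf.rightLim
  have hνIoc : ∀ a b, a ≤ b → ν (Ioc a b) = eVariationOn f.rightLim (Icc a b) := by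
    intro a b hab
    rw [hν, StieltjesFunction.measure_Ioc]
    simp only [BoundedVariationOn.stieltjesFunctionRightLim_apply]
    rw [variationOnFromTo.sub_right hf.rightLim.locallyBoundedVariationOn (mem_univ _)
      (mem_univ _) (mem_univ _), variationOnFromTo.eq_of_le _ _ hab, univ_inter,
      ENNReal.ofReal_toReal]
    exact ((eVariationOn.mono _ (subset_univ _)).trans_lt hf.rightLim.lt_top).ne
  have hA : ∀ s ∈ {s | ∃ a b, a ≤ b ∧ s = Ioc a b}, ‖AddContent.onIoc f.rightLim s‖ₑ ≤ ν s := by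
    rintro s ⟨a, b, hab, rfl⟩
    rw [AddContent.onIoc_apply hab, hνIoc a b hab, ← edist_eq_enorm_sub]
    exact eVariationOn.edist_le _ (right_mem_Icc.2 hab) (left_mem_Icc.2 hab)
  have hB : hα = MeasurableSpace.generateFrom {s | ∃ a b, a ≤ b ∧ s = Ioc a b} := by
    borelize α
    convert! borel_eq_generateFrom_Ioc_le α using 2
    grind only
  obtain ⟨m, hm, hmν⟩ := VectorMeasure.exists_extension_of_isSetSemiring_of_le_measure_of_generateFrom
    IsSetSemiring.Ioc hA hB
  have hmIoc : ∀ a b, a ≤ b → m (Ioc a b) = hf.vectorMeasure (Ioc a b) := fun a b hab => by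
    rw [hm _ ⟨a, b, hab, rfl⟩, AddContent.onIoc_apply hab, hf.vectorMeasure_Ioc hab]
  have hmIoc' : ∀ a b, m (Ioc a b) = hf.vectorMeasure (Ioc a b) := fun a b => by
    rcases le_total a b with hab | hab
    · exact hmIoc a b hab
    · simp [Ioc_eq_empty (not_lt.2 hab)]
  -- the extension is the vector measure of `f`, as both agree on the intervals `(a, b]`
  have heq : m = hf.vectorMeasure := by
    refine VectorMeasure.ext_of_generateFrom _ ?_ hB IsSetSemiring.Ioc.isPiSystem ?_
    · rintro _ ⟨a, b, hab, rfl⟩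
      exact hmIoc a b hab
    · rw [← hU]
      refine tendsto_nhds_unique
        (m.tendsto_vectorMeasure_iUnion_atTop_nat hmono fun _ => measurableSet_Ioc) ?_
      simp only [hmIoc']
      exact hf.vectorMeasure.tendsto_vectorMeasure_iUnion_atTop_nat hmono
        fun _ => measurableSet_Ioc
  refine (VectorMeasure.variation_le_of_forall_enorm_le (m := ν)
    (fun E _ => heq ▸ hmν E) univ).trans ?_
  rw [← hU]
  refine le_of_tendsto' (tendsto_measure_iUnion_atTop hmono) fun n => ?_
  rcases le_total (u n) (w n) with h | h
  · rw [hU, Function.comp_apply, hνIoc _ _ h]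
    exact eVariationOn.mono _ (subset_univ _)
  · simp [Ioc_eq_empty (not_lt.2 h)]

/-- Integration by parts against the function `x ↦ μ (x, b]`, by Fubini's theorem. -/
theorem AbsolutelyContinuousOnInterval.abs_integral_measureReal_Ioc_mul_le (μ : Measure ℝ)
    [IsFiniteMeasure μ] {η : ℝ → ℝ} {a b m : ℝ} (hab : a ≤ b)
    (hη : AbsolutelyContinuousOnInterval η a b) (hm : ∀ x ∈ Icc a b, |η x| ≤ m) :
    IntervalIntegrable (fun x => μ.real (Ioc x b) * deriv η x) volume a b ∧
      |∫ x in a..b, μ.real (Ioc x b) * deriv η x| ≤ 2 * m * μ.real univ := by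
  have hm0 : 0 ≤ m := (abs_nonneg _).trans (hm a (left_mem_Icc.2 hab))
  have hd := (intervalIntegrable_iff_integrableOn_Ioc_of_le hab).1 hη.intervalIntegrable_deriv
  set T : Set (ℝ × ℝ) := {p | p.1 < p.2 ∧ p.2 ≤ b} with hT
  have hTm : MeasurableSet T := (measurableSet_lt measurable_fst measurable_snd).inter
    (measurableSet_le measurable_snd measurable_const)
  have hint : Integrable (T.indicator fun p => deriv η p.1)
      ((volume.restrict (Ioc a b)).prod μ) :=
    (Integrable.comp_fst (f := deriv η) hd μ).indicator hTm
  have hx : ∀ x, ∫ y, T.indicator (fun p => deriv η p.1) (x, y) ∂μ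
      = μ.real (Ioc x b) * deriv η x := fun x => by
    have : (fun y => T.indicator (fun p => deriv η p.1) (x, y))
        = (Ioc x b).indicator fun _ => deriv η x := by
      ext y; by_cases hy : y ∈ Ioc x b <;> simp_all [indicator]
    rw [this, integral_indicator_const _ measurableSet_Ioc, smul_eq_mul]
  have hy : ∀ y, |∫ x in Ioc a b, T.indicator (fun p => deriv η p.1) (x, y)| ≤ 2 * m := by
    intro y
    by_cases hy : y ∈ Ioc a b
    · have : (fun x => T.indicator (fun p => deriv η p.1) (x, y))
          = (Iio y).indicator (deriv η) := by
        ext x; by_cases hx : x < y <;> simp_all [indicator]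
      rw [this, setIntegral_indicator measurableSet_Iio]
      have h2 : Ioc a b ∩ Iio y = Ioo a y := by
        ext x; simp only [mem_inter_iff, mem_Ioc, mem_Iio, mem_Ioo]
        exact ⟨fun h => ⟨h.1.1, h.2⟩, fun h => ⟨⟨h.1, h.2.le.trans hy.2⟩, h.2⟩⟩
      rw [h2, ← integral_Ioc_eq_integral_Ioo, ← intervalIntegral.integral_of_le hy.1.le,
        (hη.mono (by rw [uIcc_of_le hy.1.le, uIcc_of_le hab]
                     exact Icc_subset_Icc_right hy.2)).integral_deriv_eq_sub]
      have h3 := hm y ⟨hy.1.le, hy.2⟩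
      have h4 := hm a (left_mem_Icc.2 hab)
      linarith [abs_sub (η y) (η a)]
    · rw [setIntegral_congr_fun (g := fun _ => 0) measurableSet_Ioc]
      · simpa using hm0
      · intro x hx
        refine indicator_of_notMem (fun h => hy ⟨hx.1.trans h.1, h.2⟩) _
  constructor
  · rw [intervalIntegrable_iff_integrableOn_Ioc_of_le hab]
    exact hint.integral_prod_left.congr (Eventually.of_forall hx)
  · rw [intervalIntegral.integral_of_le hab]
    have := integral_integral_swap (f := fun x y => T.indicator (fun p => deriv η p.1) (x, y)) hint
    simp only [hx] at this
    rw [this, ← Real.norm_eq_abs]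
    exact norm_integral_le_of_norm_le_const (Eventually.of_forall fun y => hy y)

namespace AltCesaro
variable {c d : EReal}

instance noMinOrder_I (c d : EReal) : NoMinOrder (I c d) := ⟨fun ⟨x, hx⟩ => by
  obtain ⟨a, ha⟩ := mem_nhds_iff_exists_Ioo_subset.1 ((isOpen_I c d).mem_nhds hx)
  obtain ⟨b, hb, hsub⟩ := ha
  obtain ⟨y, hy⟩ := exists_between hb.1
  exact ⟨⟨y, hsub ⟨hy.1, hy.2.trans hb.2⟩⟩, hy.2⟩⟩

/-- The right limit of `h` on `(c, d)`, extended by zero. -/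
noncomputable def rightLimI (c d : EReal) (h : ℝ → ℝ) (x : ℝ) : ℝ :=
  open Classical in
  if hx : x ∈ I c d then ((I c d).domRestrict h).rightLim ⟨x, hx⟩ else 0

theorem rightLimI_coe (h : ℝ → ℝ) (x : I c d) :
    rightLimI c d h x = ((I c d).domRestrict h).rightLim x := by
  simp [rightLimI, x.2]

theorem tendsto_rightLimI {h : ℝ → ℝ} (hh : BoundedVariationOn h (I c d)) {x : ℝ}
    (hx : x ∈ I c d) : Tendsto h (𝓝[>] x) (𝓝 (rightLimI c d h x)) := by
  have h1 := (bpv_restrict hh).tendsto_rightLim ⟨x, hx⟩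
  rw [← rightLimI_coe] at h1
  have h2 := (isOpen_I c d).isOpenEmbedding_subtypeVal.map_nhdsWithin_preimage_eq (Ioi x) ⟨x, hx⟩
  rw [← h2, tendsto_map'_iff]
  exact h1

theorem totalVariation_stieltjes_le {h : ℝ → ℝ} (hh : BoundedVariationOn h (I c d)) :
    (stieltjes hh).totalVariation univ ≤ eVariationOn (rightLimI c d h) (I c d) := by
  rw [SignedMeasure.totalVariation_eq_variation]
  refine (bpv_restrict hh).variation_vectorMeasure_univ_le.trans_eq ?_
  have e := eVariationOn.comp_eq_of_monotoneOn (rightLimI c d h) ((↑) : I c d → ℝ) (t := univ)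
    (fun _ _ _ _ hab => hab)
  rw [image_univ, Subtype.range_coe] at e
  rw [← e]
  congr 1
  ext x
  exact (rightLimI_coe h x).symm

/-- If `h` vanishes near `d`, then `|∫ h η'| ≤ 2 sup |η| ‖λ_h‖`. -/
theorem abs_integral_rightLimI_mul_deriv_le {h : ℝ → ℝ} (hh : BoundedVariationOn h (I c d))
    {a b : ℝ} (ha : a ∈ I c d) (hb : b ∈ I c d) (hab : a ≤ b) (hb0 : rightLimI c d h b = 0)
    {η : ℝ → ℝ} {m : ℝ} (hη : AbsolutelyContinuousOnInterval η a b)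
    (hm : ∀ x ∈ Icc a b, |η x| ≤ m) :
    |∫ x in a..b, rightLimI c d h x * deriv η x|
      ≤ 2 * m * ((stieltjes hh).totalVariation univ).toReal := by
  set J := (stieltjes hh).toJordanDecomposition with hJ
  set μ₁ := J.posPart.map ((↑) : I c d → ℝ) with hμ₁
  set μ₂ := J.negPart.map ((↑) : I c d → ℝ) with hμ₂
  have hk : ∀ x ∈ Icc a b, rightLimI c d h x * deriv η x
      = μ₂.real (Ioc x b) * deriv η x - μ₁.real (Ioc x b) * deriv η x := by
    intro x hx
    have hxI := Icc_subset_I ha hb hx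
    have h1 : stieltjes hh (Ioc ⟨x, hxI⟩ ⟨b, hb⟩) = rightLimI c d h b - rightLimI c d h x := by
      rw [stieltjes, BoundedVariationOn.vectorMeasure_Ioc _ (show (⟨x, hxI⟩ : I c d) ≤ ⟨b, hb⟩
        from hx.2), ← rightLimI_coe, ← rightLimI_coe]
    rw [SignedMeasure.apply_eq_posPart_real_sub_negPart_real _ measurableSet_Ioc, hb0,
      zero_sub] at h1
    have h2 : ((↑) : I c d → ℝ) ⁻¹' Ioc x b = Ioc ⟨x, hxI⟩ ⟨b, hb⟩ := rfl
    rw [hμ₁, hμ₂, map_measureReal_apply measurable_subtype_coe measurableSet_Ioc,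
      map_measureReal_apply measurable_subtype_coe measurableSet_Ioc, h2]
    linear_combination deriv η x * h1
  have hu : (((stieltjes hh).totalVariation univ).toReal) = μ₁.real univ + μ₂.real univ := by
    rw [hμ₁, hμ₂, map_measureReal_apply measurable_subtype_coe MeasurableSet.univ,
      map_measureReal_apply measurable_subtype_coe MeasurableSet.univ, preimage_univ,
      SignedMeasure.totalVariation, Measure.add_apply, ENNReal.toReal_add
      (measure_ne_top _ _) (measure_ne_top _ _)]
    rfl
  obtain ⟨i₁, b₁⟩ := hη.abs_integral_measureReal_Ioc_mul_le μ₁ hab hm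
  obtain ⟨i₂, b₂⟩ := hη.abs_integral_measureReal_Ioc_mul_le μ₂ hab hm
  rw [intervalIntegral.integral_congr (g := fun x => μ₂.real (Ioc x b) * deriv η x
    - μ₁.real (Ioc x b) * deriv η x) (by rwa [uIcc_of_le hab]),
    intervalIntegral.integral_sub i₂ i₁, hu, mul_add]
  refine (abs_sub _ _).trans ?_
  linarith

theorem rightLimI_ae_eq {h : ℝ → ℝ} (hh : BoundedVariationOn h (I c d)) :
    rightLimI c d h =ᵐ[leb c d] h := by
  have h1 : ∀ᵐ x, x ∈ I c d → DifferentiableWithinAt ℝ h (I c d) x :=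
    hh.locallyBoundedVariationOn.ae_differentiableWithinAt_of_mem
  rw [EventuallyEq, ae_restrict_iff' (measurableSet_I c d)]
  filter_upwards [h1] with x hx hxI
  have h2 := ((hx hxI).continuousWithinAt.continuousAt ((isOpen_I c d).mem_nhds hxI)).tendsto
  exact tendsto_nhds_unique (tendsto_rightLimI hh hxI) (h2.mono_left nhdsWithin_le_nhds)

/-! ### Passing between extended-real classes and real-valued functions -/

theorem measurable_ereal_abs : Measurable EReal.abs :=
  EReal.measurable_of_measurable_real (by
    simp only [EReal.abs_def]
    exact (measurable_norm (α := ℝ)).ennreal_ofReal)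

theorem aemeasurable_toReal {f : ℝ → EReal} (hf : AEMeasurable f (leb c d)) :
    AEStronglyMeasurable (fun x => (f x).toReal) (leb c d) :=
  (measurable_ereal_toReal.comp_aemeasurable hf).aestronglyMeasurable

/-- The inequality is strict exactly at `±∞`, whose real value is the junk value `0`. -/
theorem enorm_toReal_le_abs (z : EReal) : ‖z.toReal‖ₑ ≤ z.abs := by
  induction z <;> simp [EReal.abs_def, Real.enorm_eq_ofReal_abs]

theorem coe_toReal_of_abs_lt_top {z : EReal} (h : z.abs < ⊤) : (z.toReal : EReal) = z := by
  induction z <;> simp_all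

theorem LocL1.locIntegrable {f : ℝ → EReal} (hm : AEMeasurable f (leb c d)) (hf : LocL1 c d f) :
    LocIntegrable c d fun x => (f x).toReal := fun x hx => by
  have h1 := (aemeasurable_toReal hm).restrict (s := Iio x)
  rw [leb_restrict] at h1
  exact ⟨h1, lt_of_le_of_lt (lintegral_mono fun y => enorm_toReal_le_abs _) (hf x hx)⟩

theorem LocL1.ae_coe_toReal (hcd : c < d) {f : ℝ → EReal} (hm : AEMeasurable f (leb c d))
    (hf : LocL1 c d f) : ∀ᵐ x ∂leb c d, ((f x).toReal : EReal) = f x := by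
  refine ae_leb_of_forall_Icc hcd fun a ha b hb hab => ?_
  have h1 := (measurable_ereal_abs.comp_aemeasurable hm).restrict (s := Iio b)
  rw [leb_restrict] at h1
  have h2 := ae_lt_top' h1 (hf b hb).ne
  rw [ae_restrict_iff' ((measurableSet_I c d).inter measurableSet_Iio)] at h2
  filter_upwards [h2, (measure_eq_zero_iff_ae_notMem (μ := volume)).1
    (Real.volume_singleton (a := b))] with y hy hyb hy'
  exact coe_toReal_of_abs_lt_top
    (hy ⟨Icc_subset_I ha hb hy', lt_of_le_of_ne hy'.2 hyb⟩)

namespace IsWeight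
variable {v : ℝ → EReal} {w : ℝ → ℝ}

theorem locIntegrable (hv : IsWeight c d v w) : LocIntegrable c d fun x => (v x).toReal :=
  hv.locL1.locIntegrable hv.aemeasurable

theorem prim_pos (hv : IsWeight c d v w) {x : ℝ} (hx : x ∈ I c d) :
    0 < prim c d (fun x => (v x).toReal) x := by
  have := hv.pos x hx
  rw [hv.eq_inv x hx] at this
  exact inv_pos.1 this

theorem inv_eq (hv : IsWeight c d v w) {x : ℝ} (hx : x ∈ I c d) :
    (w x)⁻¹ = prim c d (fun x => (v x).toReal) x := by
  rw [hv.eq_inv x hx, inv_inv]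
  rfl

end IsWeight

/-- For `f = 0`, which the supremum omits, the left-hand side is zero. -/
theorem ofReal_abs_integral_le_weakNorm {X : Set (L0 c d)} {N : L0 c d → ℝ≥0∞} {f g : L0 c d}
    (hf : f ∈ X) (hN : N f ≤ 1) :
    ENNReal.ofReal |∫ x in I c d, (f x * g x).toReal| ≤ weakNorm X N g := by
  by_cases h0 : f = 0
  · have h1 : ∫ x in I c d, (f x * g x).toReal = 0 := by
      refine integral_eq_zero_of_ae ?_
      have h2 : (f : ℝ → EReal) =ᵐ[leb c d] 0 := h0 ▸ AEEqFun.coeFn_zero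
      filter_upwards [h2] with x hx
      rw [hx]; simp
    rw [h1]; simp
  · calc ENNReal.ofReal |∫ x in I c d, (f x * g x).toReal|
        = ENNReal.ofReal |∫ x in I c d, (f x * g x).toReal| / 1 := (div_one _).symm
      _ ≤ ENNReal.ofReal |∫ x in I c d, (f x * g x).toReal| / N f := by gcongr
      _ ≤ weakNorm X N g :=
          le_iSup₂ (f := fun h (_ : h ∈ X \ {0}) =>
            ENNReal.ofReal |∫ x in I c d, (h x * g x).toReal| / N h) f ⟨hf, h0⟩

/-- A real function in `TestBall` defines a class in the altered Cesàro space, of norm at most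
`1`. -/
theorem exists_mem_ces_of_testBall (hcd : c < d) {v : ℝ → EReal} {w : ℝ → ℝ}
    (hv : IsWeight c d v w) {f : ℝ → ℝ} (hf : f ∈ TestBall c d fun x => (v x).toReal) :
    ∃ F ∈ Ces c d w, cesNorm c d w F ≤ 1 ∧ F =ᵐ[leb c d] fun x => (f x : EReal) := by
  have hm : AEStronglyMeasurable (fun x => (f x : EReal)) (leb c d) :=
    (measurable_coe_real_ereal.comp_aemeasurable
      (hf.1.aestronglyMeasurable hcd).aemeasurable).aestronglyMeasurable
  have hF := AEEqFun.coeFn_mk _ hm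
  set F : L0 c d := AEEqFun.mk _ hm
  have hFx : ∀ x, ∀ᵐ y ∂volume.restrict (I c d ∩ Iio x), F y = (f y : EReal) := fun x => by
    have := ae_restrict_of_ae (s := Iio x) hF
    rwa [leb_restrict] at this
  have hprim : ∀ x, primitive c d F x = prim c d f x := fun x => by
    refine integral_congr_ae ?_
    filter_upwards [hFx x] with y hy
    rw [hy, EReal.toReal_coe]
  have hN : cesNorm c d w F ≤ 1 := by
    refine essSup_le_of_ae_le _ ?_
    filter_upwards [ae_restrict_mem (measurableSet_I c d)] with x hx
    rw [hprim, ← ENNReal.ofReal_one]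
    refine ENNReal.ofReal_le_ofReal ?_
    have h1 := hv.inv_eq hx
    have h2 := hv.pos x hx
    rw [abs_mul, abs_of_pos h2]
    calc w x * |prim c d f x| ≤ w x * (w x)⁻¹ := by
          gcongr; rw [h1]; exact hf.2 x hx
      _ = 1 := mul_inv_cancel₀ h2.ne'
  refine ⟨F, ⟨fun x hx => ?_, hN.trans_lt ENNReal.one_lt_top⟩, hN, hF⟩
  have h1 : ∫⁻ y in I c d ∩ Iio x, (F y).abs = ∫⁻ y in I c d ∩ Iio x, ‖f y‖ₑ := by
    refine lintegral_congr_ae ?_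
    filter_upwards [hFx x] with y hy
    rw [hy, EReal.abs_def, Real.enorm_eq_ofReal_abs]
  rw [h1]
  exact (hf.1 x hx).2

/-! ### Necessity -/

section Necessity
variable {v : ℝ → EReal} {w : ℝ → ℝ} {g : L0 c d}

theorem lintegral_lt_top_of_mem_weakAssociate (hcd : c < d) (hv : IsWeight c d v w)
    (hg : g ∈ weakAssociate (Ces c d w) (cesNorm c d w)) {f : ℝ → ℝ}
    (hf : f ∈ TestBall c d fun x => (v x).toReal) :
    ∫⁻ x in I c d, ENNReal.ofReal |f x| * (g x).abs < ⊤ := by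
  obtain ⟨F, hF, -, hFf⟩ := exists_mem_ces_of_testBall hcd hv hf
  refine lt_of_eq_of_lt (lintegral_congr_ae ?_) (hg.1 F hF)
  filter_upwards [hFf] with x hx
  rw [EReal.abs_mul, hx, EReal.abs_def]

theorem abs_integral_le_of_mem_weakAssociate (hcd : c < d) (hv : IsWeight c d v w)
    (hg : g ∈ weakAssociate (Ces c d w) (cesNorm c d w)) {f : ℝ → ℝ}
    (hf : f ∈ TestBall c d fun x => (v x).toReal) :
    |∫ x in I c d, f x * (g x).toReal|
      ≤ (weakNorm (Ces c d w) (cesNorm c d w) g).toReal := by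
  obtain ⟨F, hF, hN, hFf⟩ := exists_mem_ces_of_testBall hcd hv hf
  have h1 := ofReal_abs_integral_le_weakNorm (g := g) hF hN
  have h2 : ∫ x in I c d, (F x * g x).toReal = ∫ x in I c d, f x * (g x).toReal := by
    refine integral_congr_ae ?_
    filter_upwards [hFf] with x hx
    rw [hx, EReal.toReal_mul, EReal.toReal_coe]
  rw [h2] at h1
  exact (ENNReal.ofReal_le_iff_le_toReal hg.2.ne).1 h1

theorem integrable_mul_of_testBall (hcd : c < d) (hv : IsWeight c d v w)
    (hg : g ∈ weakAssociate (Ces c d w) (cesNorm c d w)) {f : ℝ → ℝ}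
    (hf : f ∈ TestBall c d fun x => (v x).toReal) :
    Integrable (fun x => f x * (g x).toReal) (leb c d) := by
  refine ⟨(hf.1.aestronglyMeasurable hcd).mul (aemeasurable_toReal g.aemeasurable),
    lt_of_le_of_lt (lintegral_mono fun x => ?_) (lintegral_lt_top_of_mem_weakAssociate hcd hv hg hf)⟩
  rw [enorm_mul, ← Real.enorm_eq_ofReal_abs]
  gcongr
  exact enorm_toReal_le_abs _

theorem weight_mem_testBall (hv : IsWeight c d v w) :
    (fun x => (v x).toReal) ∈ TestBall c d fun x => (v x).toReal :=
  ⟨hv.locIntegrable, fun _ hx => (abs_of_pos (hv.prim_pos hx)).le⟩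

theorem normL1_eq_ofReal_integral (hcd : c < d) (hv : IsWeight c d v w)
    (hgf : ∀ᵐ x ∂leb c d, ((g x).toReal : EReal) = g x)
    (hi : Integrable (fun x => (v x).toReal * (g x).toReal) (leb c d)) :
    normL1 c d (fun x => v x * g x)
      = ENNReal.ofReal (∫ x in I c d, |(v x).toReal * (g x).toReal|) := by
  have h1 := ofReal_integral_norm_eq_lintegral_enorm hi
  simp only [Real.norm_eq_abs] at h1
  rw [h1]
  refine lintegral_congr_ae ?_
  filter_upwards [hgf, hv.locL1.ae_coe_toReal hcd hv.aemeasurable] with x h2 h3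
  rw [← h2, ← h3, ← EReal.coe_mul, EReal.abs_def, Real.enorm_eq_ofReal_abs]
  simp

/-- A measurable representative of `|g|`, with the integrability property that makes `g` bounded
and zero near `d`. -/
theorem measurable_rep_of_mem_weakAssociate (hcd : c < d) (hv : IsWeight c d v w)
    (hg : g ∈ weakAssociate (Ces c d w) (cesNorm c d w)) :
    ∃ γ : ℝ → ℝ≥0∞, Measurable γ ∧ (fun x => (g x).abs) =ᵐ[leb c d] γ ∧
      ∀ φ : ℝ → ℝ, LocIntegrable c d φ → ∫⁻ x in I c d, ENNReal.ofReal |φ x| * γ x < ⊤ := by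
  have hm : AEMeasurable (fun x => (g x).abs) (leb c d) :=
    measurable_ereal_abs.comp_aemeasurable g.aemeasurable
  refine ⟨hm.mk _, hm.measurable_mk, hm.ae_eq_mk, fun φ hφ => ?_⟩
  refine lt_of_eq_of_lt (lintegral_congr_ae ?_) (lintegral_mul_lt_top_of_testBall hcd
    hv.locIntegrable (fun x hx => hv.prim_pos hx) hm
    (fun f hf => lintegral_lt_top_of_mem_weakAssociate hcd hv hg hf) hφ)
  filter_upwards [hm.ae_eq_mk] with x hx
  rw [hx]

theorem normLinfty_lt_top_of_mem_weakAssociate (hcd : c < d) (hv : IsWeight c d v w)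
    (hg : g ∈ weakAssociate (Ces c d w) (cesNorm c d w)) : normLinfty c d g < ⊤ := by
  obtain ⟨γ, hγ, he, H⟩ := measurable_rep_of_mem_weakAssociate hcd hv hg
  rw [normLinfty, essSup_congr_ae he]
  exact essSup_lt_top_of_lintegral hcd hγ H

theorem exists_ae_eq_zero_of_mem_weakAssociate (hcd : c < d) (hv : IsWeight c d v w)
    (hg : g ∈ weakAssociate (Ces c d w) (cesNorm c d w)) :
    ∃ b ∈ I c d, ∀ᵐ x ∂leb c d, b < x → g x = 0 := by
  obtain ⟨γ, hγ, he, H⟩ := measurable_rep_of_mem_weakAssociate hcd hv hg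
  obtain ⟨b, hb, h0⟩ := exists_ae_eq_zero_of_lintegral hcd hγ H
  refine ⟨b, hb, ?_⟩
  filter_upwards [he, h0] with x h1 h2 h3
  rw [← EReal.abs_eq_zero_iff, h1, h2 h3]

theorem ae_abs_toReal_le (h : normLinfty c d g < ⊤) :
    ∀ᵐ x ∂leb c d, ((g x).toReal : EReal) = g x ∧ |(g x).toReal| ≤ (normLinfty c d g).toReal := by
  have h1 : ∀ᵐ x ∂leb c d, (g x).abs ≤ normLinfty c d g := ae_le_essSup
  filter_upwards [h1] with x hx
  refine ⟨coe_toReal_of_abs_lt_top (hx.trans_lt h), ?_⟩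
  rw [← ENNReal.ofReal_le_iff_le_toReal h.ne, ← Real.enorm_eq_ofReal_abs]
  exact (enorm_toReal_le_abs _).trans hx

theorem intervalIntegrable_prim_mul (hv : IsWeight c d v w) (h : normLinfty c d g < ⊤) {a b : ℝ}
    (ha : a ∈ I c d) (hb : b ∈ I c d) :
    IntervalIntegrable (fun x => prim c d (fun x => (v x).toReal) x * (g x).toReal) volume a b := by
  have h1 : IntervalIntegrable (fun x => (g x).toReal) volume a b := by
    rw [intervalIntegrable_iff]
    have hs : uIoc a b ⊆ I c d := uIoc_subset_uIcc.trans (uIcc_subset_I ha hb)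
    have : IsFiniteMeasure (volume.restrict (uIoc a b)) := by unfold uIoc; infer_instance
    refine Integrable.of_bound (C := (normLinfty c d g).toReal) ?_ ?_
    · exact (aemeasurable_toReal g.aemeasurable).mono_measure (Measure.restrict_mono hs le_rfl)
    · exact ae_mono (Measure.restrict_mono hs le_rfl) ((ae_abs_toReal_le h).mono fun x hx => hx.2)
  exact h1.continuousOn_mul ((prim_continuousOn hv.locIntegrable).mono (uIcc_subset_I ha hb))

/-- Testing with `(V η)' = v η + V η'` bounds `∫ (g / w) η'`. -/
theorem weakVariationLE_of_mem_weakAssociate (hcd : c < d) (hv : IsWeight c d v w)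
    (hg : g ∈ weakAssociate (Ces c d w) (cesNorm c d w)) :
    WeakVariationLE c d (fun x => prim c d (fun x => (v x).toReal) x * (g x).toReal)
      ((weakNorm (Ces c d w) (cesNorm c d w) g).toReal
        + ∫ x in I c d, |(v x).toReal * (g x).toReal|) := by
  intro η η' hη hη' hb hm ⟨C, hC⟩ ⟨α, hα, β, hβ, hsupp⟩
  set u : ℝ → ℝ := fun x => (v x).toReal with hu
  have hV := prim_continuousOn hv.locIntegrable
  have hαβ := Icc_subset_I hα hβ
  have hL : LocIntegrable c d (fun x => prim c d u x * η' x) := by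
    obtain ⟨B, hB⟩ := isCompact_Icc.exists_bound_of_continuousOn (hV.mono hαβ)
    have h1 : IntegrableOn (fun x => prim c d u x * η' x) (Icc α β) := by
      refine Integrable.of_bound (C := B * C) ?_ ?_
      · exact ((hV.mono hαβ).aestronglyMeasurable measurableSet_Icc).mul
          hm.aestronglyMeasurable
      · filter_upwards [ae_restrict_mem measurableSet_Icc] with x hx
        rw [norm_mul]
        have := (norm_nonneg _).trans (hB x hx)
        gcongr
        · exact hB x hx
        · exact hC x
    have h2 : (fun x => prim c d u x * η' x)
        = (Icc α β).indicator fun x => prim c d u x * η' x := by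
      ext x
      by_cases hx : x ∈ Icc α β
      · rw [indicator_of_mem hx]
      · rw [indicator_of_notMem hx, hsupp x hx, mul_zero]
    have h3 : Integrable (fun x => prim c d u x * η' x) volume := by
      rw [h2]; exact (integrable_indicator_iff measurableSet_Icc).2 h1
    exact fun x _ => h3.integrableOn
  have hball := test_mem hcd hv.locIntegrable (fun x hx => hv.prim_pos hx) hη hη' hb hL
  have i1 := integrable_mul_of_testBall hcd hv hg hball
  have i2 := integrable_mul_of_testBall hcd hv hg (weight_mem_testBall hv)
  have i3 : Integrable (fun x => u x * (g x).toReal * η x) (leb c d) := by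
    refine i2.mono (i2.aestronglyMeasurable.mul ((continuousOn_of_ac hη).aestronglyMeasurable
      (measurableSet_I c d))) ?_
    filter_upwards [ae_restrict_mem (measurableSet_I c d)] with x hx
    rw [norm_mul]
    exact mul_le_of_le_one_right (norm_nonneg _) (hb x hx)
  have h4 : ∫ x in I c d, prim c d u x * (g x).toReal * η' x
      = (∫ x in I c d, (u x * η x + prim c d u x * η' x) * (g x).toReal)
        - ∫ x in I c d, u x * (g x).toReal * η x := by
    rw [← integral_sub i1 i3]
    refine integral_congr_ae (Eventually.of_forall fun x => ?_)
    ring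
  rw [h4]
  refine (abs_sub _ _).trans (add_le_add
    (abs_integral_le_of_mem_weakAssociate hcd hv hg hball) ?_)
  refine (abs_integral_le_integral_abs).trans (integral_mono_ae i3.abs i2.abs ?_)
  filter_upwards [ae_restrict_mem (measurableSet_I c d)] with x hx
  rw [abs_mul]
  exact mul_le_of_le_one_right (abs_nonneg _) (hb x hx)

theorem ae_eq_rep_iff (hv : IsWeight c d v w) (h : normLinfty c d g < ⊤) {k : ℝ → ℝ} :
    (∀ᵐ x ∂leb c d, (k x : EReal) = ((w x)⁻¹ : ℝ) * g x) ↔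
      (fun x => prim c d (fun x => (v x).toReal) x * (g x).toReal) =ᵐ[leb c d] k := by
  have : ∀ᵐ x ∂leb c d, ((k x : EReal) = ((w x)⁻¹ : ℝ) * g x ↔
      prim c d (fun x => (v x).toReal) x * (g x).toReal = k x) := by
    filter_upwards [ae_abs_toReal_le h, ae_restrict_mem (measurableSet_I c d)] with x h1 hx
    rw [hv.inv_eq hx]
    nth_rw 1 [← h1.1]
    rw [← EReal.coe_mul, EReal.coe_eq_coe_iff, eq_comm]
  exact eventually_congr this

/-- If `v > 0` a.e., then `v sgn g` belongs to the unit ball, as `|∫_c^x v sgn g| ≤ ∫_c^x v`. -/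
theorem integral_abs_le_of_mem_weakAssociate (hcd : c < d) (hv : IsWeight c d v w)
    (hpos : ∀ᵐ x ∂leb c d, 0 < v x)
    (hg : g ∈ weakAssociate (Ces c d w) (cesNorm c d w)) :
    ∫ x in I c d, |(v x).toReal * (g x).toReal|
      ≤ (weakNorm (Ces c d w) (cesNorm c d w) g).toReal := by
  set s : ℝ → ℝ := fun t => if 0 ≤ t then 1 else -1 with hs
  have hsm : Measurable s := Measurable.ite measurableSet_Ici measurable_const measurable_const
  have hs1 : ∀ t, |s t| = 1 := fun t => by simp only [hs]; split_ifs <;> simp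
  have hst : ∀ t, s t * t = |t| := fun t => by
    simp only [hs]; split_ifs with h
    · rw [abs_of_nonneg h, one_mul]
    · rw [abs_of_neg (not_le.1 h), neg_one_mul]
  have hu0 : ∀ᵐ x ∂leb c d, 0 ≤ (v x).toReal := hpos.mono fun x hx => EReal.toReal_nonneg hx.le
  have hL : LocIntegrable c d fun x => (v x).toReal * s (g x).toReal := by
    refine hv.locIntegrable.mono ((hv.locIntegrable.aestronglyMeasurable hcd).mul
      (hsm.comp_aemeasurable
        (aemeasurable_toReal g.aemeasurable).aemeasurable).aestronglyMeasurable) ?_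
    refine Eventually.of_forall fun x => ?_
    rw [abs_mul, hs1, mul_one]
  have hball : (fun x => (v x).toReal * s (g x).toReal) ∈ TestBall c d fun x => (v x).toReal := by
    refine ⟨hL, fun x hx => abs_integral_le_integral_abs.trans (le_of_eq ?_)⟩
    refine integral_congr_ae ?_
    have := ae_restrict_of_ae (s := Iio x) hu0
    rw [leb_restrict] at this
    filter_upwards [this] with y hy
    rw [abs_mul, hs1, mul_one, abs_of_nonneg hy]
  refine le_trans (le_of_eq ?_) ((le_abs_self _).trans
    (abs_integral_le_of_mem_weakAssociate hcd hv hg hball))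
  refine integral_congr_ae ?_
  filter_upwards [hu0] with x hx
  rw [mul_assoc, hst, abs_mul, abs_of_nonneg hx]

end Necessity

/-! ### Sufficiency -/

section Sufficiency
variable {v : ℝ → EReal} {w : ℝ → ℝ} {g : L0 c d}

/-- The essential supremum in the norm is attained pointwise, because primitives are
continuous. -/
theorem abs_prim_le_of_mem_ces (hv : IsWeight c d v w) {f : L0 c d} (hf : f ∈ Ces c d w) :
    ∀ x ∈ I c d, |prim c d (fun x => (f x).toReal) x|
      ≤ (cesNorm c d w f).toReal * prim c d (fun x => (v x).toReal) x := by
  have hP := (prim_continuousOn (hf.1.locIntegrable f.aemeasurable)).abs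
  have hV := (prim_continuousOn hv.locIntegrable).const_mul (cesNorm c d w f).toReal
  have h1 : ∀ᵐ x ∂leb c d, ENNReal.ofReal |w x * primitive c d f x| ≤ cesNorm c d w f :=
    ae_le_essSup
  have h2 : (fun x => max (|prim c d (fun x => (f x).toReal) x|)
      ((cesNorm c d w f).toReal * prim c d (fun x => (v x).toReal) x)) =ᵐ[leb c d]
      fun x => (cesNorm c d w f).toReal * prim c d (fun x => (v x).toReal) x := by
    filter_upwards [h1, ae_restrict_mem (measurableSet_I c d)] with x hx hxI
    rw [ENNReal.ofReal_le_iff_le_toReal hf.2.ne, abs_mul, abs_of_pos (hv.pos x hxI),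
      mul_comm, ← le_div_iff₀ (hv.pos x hxI), div_eq_mul_inv, hv.inv_eq hxI] at hx
    exact max_eq_right hx
  have h3 := Measure.eqOn_open_of_ae_eq h2 (isOpen_I c d) (ContinuousOn.sup hP hV) hV
  exact fun x hx => (le_max_left _ _).trans_eq (h3 hx)

theorem normL1_mul_lt_top_of_mem_ces {f : L0 c d} (hf : f ∈ Ces c d w)
    (hgb : normLinfty c d g < ⊤) {b : ℝ} (hb : b ∈ I c d)
    (h0 : ∀ᵐ x ∂leb c d, b < x → g x = 0) :
    normL1 c d (fun x => f x * g x) < ⊤ := by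
  have h1 : ∀ᵐ x ∂leb c d, (g x).abs ≤ normLinfty c d g := ae_le_essSup
  have h2 : normL1 c d (fun x => f x * g x)
      ≤ ∫⁻ x in I c d, (Iio b).indicator (fun x => normLinfty c d g * (f x).abs) x := by
    refine lintegral_mono_ae ?_
    filter_upwards [h1, h0, ae_ne_leb c d b] with x h3 h4 h5
    rw [EReal.abs_mul]
    rcases lt_or_gt_of_ne h5 with h6 | h6
    · rw [indicator_of_mem (show x ∈ Iio b from h6), mul_comm]
      gcongr
    · rw [h4 h6]; simp
  refine h2.trans_lt ?_
  rw [lintegral_indicator measurableSet_Iio, leb_restrict, lintegral_const_mul' _ _ hgb.ne]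
  exact ENNReal.mul_lt_top hgb (hf.1 b hb)

/-- With `F = ∫_c f` and `η = F / V`, `f g = (V g) η' + v g η`, and the first term is integrated by
parts. -/
theorem abs_integral_mul_le_of_mem_ces (hcd : c < d) (hv : IsWeight c d v w) {f : L0 c d}
    (hf : f ∈ Ces c d w) (hgb : normLinfty c d g < ⊤) {b : ℝ} (hb : b ∈ I c d)
    (h0 : ∀ᵐ x ∂leb c d, b < x → g x = 0)
    (hi : Integrable (fun x => (v x).toReal * (g x).toReal) (leb c d))
    {h : ℝ → ℝ} (hh : IsBPVRep w g h) :
    |∫ x in I c d, (f x * g x).toReal| ≤ (cesNorm c d w f).toReal *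
      ((∫ x in I c d, |(v x).toReal * (g x).toReal|)
        + 2 * ((stieltjes hh.1).totalVariation univ).toReal) := by
  set u : ℝ → ℝ := fun x => (v x).toReal with hu
  set φ : ℝ → ℝ := fun x => (f x).toReal with hφ
  set γ : ℝ → ℝ := fun x => (g x).toReal with hγ
  set m := (cesNorm c d w f).toReal with hm
  have hm0 : 0 ≤ m := ENNReal.toReal_nonneg
  have hV0 : ∀ x ∈ I c d, 0 < prim c d u x := fun x hx => hv.prim_pos hx
  have hVr := (ae_eq_rep_iff hv hgb).1 hh.2
  have hφL : LocIntegrable c d φ := hf.1.locIntegrable f.aemeasurable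
  have hprim := abs_prim_le_of_mem_ces hv hf
  have hfg : Integrable (fun x => φ x * γ x) (leb c d) := by
    refine ⟨(hφL.aestronglyMeasurable hcd).mul (aemeasurable_toReal g.aemeasurable),
      lt_of_le_of_lt (lintegral_mono fun x => ?_)
      (normL1_mul_lt_top_of_mem_ces hf hgb hb h0)⟩
    rw [EReal.abs_mul, enorm_mul]
    exact mul_le_mul' (enorm_toReal_le_abs _) (enorm_toReal_le_abs _)
  set η : ℝ → ℝ := fun x => prim c d φ x * (prim c d u x)⁻¹ with hη
  have hηb : ∀ x ∈ I c d, |η x| ≤ m := fun x hx => by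
    rw [hη, abs_mul, abs_inv, abs_of_pos (hV0 x hx), ← div_eq_mul_inv, div_le_iff₀ (hV0 x hx)]
    exact hprim x hx
  have hηac : ∀ a ∈ I c d, ∀ b ∈ I c d, AbsolutelyContinuousOnInterval η a b :=
    fun a ha b hb => (prim_ac hφL ha hb).mul
      ((prim_ac hv.locIntegrable ha hb).inv fun x hx => hV0 x (uIcc_subset_I ha hb hx))
  have hugη : Integrable (fun x => u x * γ x * η x) (leb c d) := by
    refine (hi.norm.mul_const m).mono (hi.aestronglyMeasurable.mul
      ((continuousOn_of_ac hηac).aestronglyMeasurable (measurableSet_I c d))) ?_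
    filter_upwards [ae_restrict_mem (measurableSet_I c d)] with x hx
    rw [norm_mul, norm_mul (‖_‖), norm_norm, Real.norm_of_nonneg hm0]
    gcongr
    exact hηb x hx
  -- the product rule, with `V g` replaced by the right limit of `h`
  have hid : ∀ᵐ x ∂leb c d, φ x * γ x
      = rightLimI c d h x * deriv η x + u x * γ x * η x := by
    filter_upwards [prim_ae_hasDerivAt hcd hφL, prim_ae_hasDerivAt hcd hv.locIntegrable, hVr,
      rightLimI_ae_eq hh.1, ae_restrict_mem (measurableSet_I c d)] with x h1 h2 h3 h4 hx
    have h5 := hV0 x hx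
    have h6 : deriv η x = φ x * (prim c d u x)⁻¹
        + prim c d φ x * (-u x / prim c d u x ^ 2) := (h1.mul (h2.inv h5.ne')).deriv
    rw [h4, ← h3, h6]
    change φ x * γ x = prim c d u x * γ x * _ + u x * γ x * (prim c d φ x * (prim c d u x)⁻¹)
    field_simp
    ring
  -- the right limit of `h` vanishes almost everywhere on `(b, d)`
  obtain ⟨b', hb', hbb', hb0⟩ : ∃ b' ∈ I c d, b < b' ∧ rightLimI c d h b' = 0 := by
    by_contra! hcon
    have h1 : ∀ᵐ x ∂leb c d, ¬ b < x := by
      filter_upwards [h0, hVr, rightLimI_ae_eq hh.1, ae_restrict_mem (measurableSet_I c d)]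
        with x h1 h2 h3 hx hbx
      refine hcon x hx hbx ?_
      rw [h3, ← h2, h1 hbx, EReal.toReal_zero, mul_zero]
    obtain ⟨e, -, he, he'⟩ := exists_seq_right hcd
    obtain ⟨n, hn⟩ := (he' b hb).exists
    rw [ae_restrict_iff' (measurableSet_I c d), ae_iff] at h1
    have h2 : volume (Ioo b (e n)) ≤ 0 := by
      rw [← h1]
      refine measure_mono fun x hx => ?_
      simp only [mem_ofPred_eq, Classical.not_imp, not_not]
      exact ⟨Icc_subset_I hb (he n) ⟨hx.1.le, hx.2.le⟩, hx.1⟩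
    rw [Real.volume_Ioo, nonpos_iff_eq_zero, ENNReal.ofReal_eq_zero] at h2
    linarith
  have hfgL : LocIntegrable c d fun x => φ x * γ x := fun x _ => hfg.mono_measure
    (Measure.restrict_mono inter_subset_left le_rfl)
  have htot : ∫ x in I c d, (f x * g x).toReal = prim c d (fun x => φ x * γ x) b' := by
    rw [prim, ← leb_restrict, ← integral_indicator measurableSet_Iio]
    refine integral_congr_ae ?_
    filter_upwards [h0, ae_ne_leb c d b'] with x h1 h2
    rw [EReal.toReal_mul]
    rcases lt_or_gt_of_ne h2 with h3 | h3
    · rw [indicator_of_mem (show x ∈ Iio b' from h3)]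
    · rw [indicator_of_notMem (show x ∉ Iio b' from fun h4 => lt_asymm h3 h4), h1 (hbb'.trans h3), EReal.toReal_zero,
        mul_zero]
  obtain ⟨a, ha, haI, ha'⟩ := exists_seq_left hcd
  have hlim := (tendsto_const_nhds (x := prim c d (fun x => φ x * γ x) b')).sub
    (prim_tendsto_zero hfgL ha haI ha')
  rw [sub_zero] at hlim
  rw [htot]
  refine le_of_tendsto hlim.abs ?_
  filter_upwards [ha' b' hb'] with n hn
  have hsub : uIoc (a n) b' ⊆ I c d := uIoc_subset_uIcc.trans (uIcc_subset_I (haI n) hb')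
  have ii : ∀ {q : ℝ → ℝ}, Integrable q (leb c d) → IntervalIntegrable q volume (a n) b' :=
    fun hq => intervalIntegrable_iff.2 (hq.mono_measure (Measure.restrict_mono hsub le_rfl))
  rw [ae_restrict_iff' (measurableSet_I c d)] at hid
  have hsplit : ∫ x in a n..b', rightLimI c d h x * deriv η x
      = (∫ x in a n..b', φ x * γ x) - ∫ x in a n..b', u x * γ x * η x := by
    rw [← intervalIntegral.integral_sub (ii hfg) (ii hugη)]
    refine intervalIntegral.integral_congr_ae ?_
    filter_upwards [hid] with x hx hx'
    rw [hx (hsub hx')]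
    ring
  have hpart := abs_integral_rightLimI_mul_deriv_le hh.1 (haI n) hb' hn.le hb0
    (hηac _ (haI n) _ hb') fun x hx => hηb x (Icc_subset_I (haI n) hb' hx)
  have hrest : |∫ x in a n..b', u x * γ x * η x| ≤ m * ∫ x in I c d, |u x * γ x| := by
    rw [intervalIntegral.integral_of_le hn.le]
    rw [uIoc_of_le hn.le] at hsub
    refine abs_integral_le_integral_abs.trans ?_
    rw [← integral_const_mul]
    refine (setIntegral_mono_set hugη.abs (Eventually.of_forall fun x => abs_nonneg _)
      hsub.eventuallyLE).trans ?_
    refine integral_mono_ae hugη.abs (hi.abs.const_mul m) ?_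
    filter_upwards [ae_restrict_mem (measurableSet_I c d)] with x hx
    rw [abs_mul, mul_comm]
    gcongr
    exact hηb x hx
  have hfin : prim c d (fun x => φ x * γ x) b' - prim c d (fun x => φ x * γ x) (a n)
      = (∫ x in a n..b', rightLimI c d h x * deriv η x) + ∫ x in a n..b', u x * γ x * η x := by
    rw [prim_eq_add hfgL (haI n) hb', hsplit]; ring
  rw [hfin]
  refine (abs_add_le _ _).trans ((add_le_add hpart hrest).trans_eq ?_)
  ring

theorem weakNorm_le (hcd : c < d) (hv : IsWeight c d v w)
    (hgb : normLinfty c d g < ⊤) {b : ℝ} (hb : b ∈ I c d)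
    (h0 : ∀ᵐ x ∂leb c d, b < x → g x = 0)
    (hi : Integrable (fun x => (v x).toReal * (g x).toReal) (leb c d))
    {h : ℝ → ℝ} (hh : IsBPVRep w g h) :
    weakNorm (Ces c d w) (cesNorm c d w) g
      ≤ normL1 c d (fun x => v x * g x) + 2 * (stieltjes hh.1).totalVariation univ := by
  refine iSup₂_le fun f hf => ENNReal.div_le_of_le_mul ?_
  have h1 := abs_integral_mul_le_of_mem_ces hcd hv hf.1 hgb hb h0 hi hh
  refine (ENNReal.ofReal_le_ofReal h1).trans (le_of_eq ?_)
  have hL : 0 ≤ ∫ x in I c d, |(v x).toReal * (g x).toReal| :=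
    integral_nonneg fun _ => abs_nonneg _
  rw [ENNReal.ofReal_mul ENNReal.toReal_nonneg, ENNReal.ofReal_toReal hf.1.2.ne,
    ENNReal.ofReal_add hL (by positivity), ENNReal.ofReal_mul zero_le_two,
    ENNReal.ofReal_toReal (measure_ne_top _ _),
    normL1_eq_ofReal_integral hcd hv ((ae_abs_toReal_le hgb).mono fun x hx => hx.1) hi, mul_comm,
    ENNReal.ofReal_ofNat]

end Sufficiency

end AltCesaro

open AltCesaro in
theorem mainTheorem4 :
    (∀ (c d : EReal) (v : ℝ → EReal) (w : ℝ → ℝ) (g : AltCesaro.L0 c d),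
      c < d → AltCesaro.IsWeight c d v w →
      (g ∈ AltCesaro.weakAssociate (AltCesaro.Ces c d w) (AltCesaro.cesNorm c d w) ↔
        AltCesaro.normL1 c d (fun x => v x * g x) < ⊤ ∧
        (∃ h : ℝ → ℝ, AltCesaro.IsBPVRep w g h) ∧
        AltCesaro.normLinfty c d g < ⊤ ∧
        ∃ b ∈ AltCesaro.I c d, ∀ᵐ x ∂AltCesaro.leb c d, b < x → g x = 0)) ∧
    ∃ C : ℝ≥0, ∀ (c d : EReal) (v : ℝ → EReal) (w : ℝ → ℝ) (g : AltCesaro.L0 c d),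
      c < d → AltCesaro.IsWeight c d v w → (∀ᵐ x ∂AltCesaro.leb c d, 0 < v x) →
      g ∈ AltCesaro.weakAssociate (AltCesaro.Ces c d w) (AltCesaro.cesNorm c d w) →
      ∀ (h : ℝ → ℝ) (hh : AltCesaro.IsBPVRep w g h),
        AltCesaro.weakNorm (AltCesaro.Ces c d w) (AltCesaro.cesNorm c d w) g ≤
          C * (AltCesaro.normL1 c d (fun x => v x * g x) +
            (AltCesaro.stieltjes hh.1).totalVariation univ) ∧
        AltCesaro.normL1 c d (fun x => v x * g x) +
            (AltCesaro.stieltjes hh.1).totalVariation univ ≤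
          C * AltCesaro.weakNorm (AltCesaro.Ces c d w) (AltCesaro.cesNorm c d w) g := by
  refine ⟨fun c d v w g hcd hv => ⟨fun hg => ?_, fun ⟨h1, ⟨h, hh⟩, hgb, b, hb, h0⟩ => ?_⟩,
    3, fun c d v w g hcd hv hpos hg h hh => ?_⟩
  · have hgb := normLinfty_lt_top_of_mem_weakAssociate hcd hv hg
    have hi := integrable_mul_of_testBall hcd hv hg (weight_mem_testBall hv)
    refine ⟨?_, ?_, hgb, exists_ae_eq_zero_of_mem_weakAssociate hcd hv hg⟩
    · rw [normL1_eq_ofReal_integral hcd hv ((ae_abs_toReal_le hgb).mono fun x hx => hx.1) hi]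
      exact ENNReal.ofReal_lt_top
    · obtain ⟨h, hh, hH⟩ := exists_boundedVariationOn_ae_eq hcd
        (fun a ha b hb => intervalIntegrable_prim_mul hv hgb ha hb)
        (weakVariationLE_of_mem_weakAssociate hcd hv hg)
      exact ⟨h, hh, (ae_eq_rep_iff hv hgb).2 hH⟩
  · have hi : Integrable (fun x => (v x).toReal * (g x).toReal) (leb c d) := by
      refine ⟨(aemeasurable_toReal hv.aemeasurable).mul (aemeasurable_toReal g.aemeasurable),
        lt_of_le_of_lt (lintegral_mono fun x => ?_) h1⟩
      rw [EReal.abs_mul, enorm_mul]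
      exact mul_le_mul' (enorm_toReal_le_abs _) (enorm_toReal_le_abs _)
    refine ⟨fun f hf => normL1_mul_lt_top_of_mem_ces hf hgb hb h0,
      (weakNorm_le hcd hv hgb hb h0 hi hh).trans_lt (ENNReal.add_lt_top.2 ⟨h1, ?_⟩)⟩
    exact ENNReal.mul_lt_top ENNReal.ofNat_lt_top (measure_lt_top _ _)
  · have hgb := normLinfty_lt_top_of_mem_weakAssociate hcd hv hg
    have hi := integrable_mul_of_testBall hcd hv hg (weight_mem_testBall hv)
    have hgf := (ae_abs_toReal_le hgb).mono fun x hx => hx.1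
    obtain ⟨b, hb, h0⟩ := exists_ae_eq_zero_of_mem_weakAssociate hcd hv hg
    set N := weakNorm (Ces c d w) (cesNorm c d w) g with hN
    set L := normL1 c d (fun x => v x * g x) with hL
    set T := (stieltjes hh.1).totalVariation univ with hT
    have hLe : L = ENNReal.ofReal (∫ x in I c d, |(v x).toReal * (g x).toReal|) :=
      normL1_eq_ofReal_integral hcd hv hgf hi
    have hLN : L ≤ N := by
      rw [hLe]
      exact ENNReal.ofReal_le_of_le_toReal (integral_abs_le_of_mem_weakAssociate hcd hv hpos hg)
    have hTN : T ≤ N + L := by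
      refine (totalVariation_stieltjes_le hh.1).trans
        ((eVariationOn_rightLim_le_of_weakVariationLE hcd
          (fun a ha b hb => intervalIntegrable_prim_mul hv hgb ha hb)
          (weakVariationLE_of_mem_weakAssociate hcd hv hg)
          ((ae_eq_rep_iff hv hgb).1 hh.2)
          fun x hx => tendsto_rightLimI hh.1 hx).trans (le_of_eq ?_))
      rw [ENNReal.ofReal_add ENNReal.toReal_nonneg (integral_nonneg fun _ => abs_nonneg _),
        ENNReal.ofReal_toReal hg.2.ne, hLe]
    constructor
    · calc N ≤ L + 2 * T := weakNorm_le hcd hv hgb hb h0 hi hh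
        _ ≤ 3 * L + 3 * T := by
            gcongr
            · exact le_mul_of_one_le_left zero_le (by norm_num)
            · norm_num
        _ = ((3 : ℝ≥0) : ℝ≥0∞) * (L + T) := by rw [mul_add]; norm_num
    · calc L + T ≤ N + (N + N) := by gcongr; exact hTN.trans (by gcongr)
        _ = ((3 : ℝ≥0) : ℝ≥0∞) * N := by
            rw [show ((3 : ℝ≥0) : ℝ≥0∞) = 1 + (1 + 1) by norm_num]; ring
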